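/- Let $k$ be an algebraically closed field of characteristic $\neq 2$, let $C$ be a smooth projective non-hyperelliptic curve of genus $4$ over $k$, and let $\eta$ be a divisor on $C$ whose class is a non-trivial $2$-torsion point of $\mathrm{Jac}(C)$. Fix an isomorphism $\mathcal O_C(2\eta)\cong\mathcal O_C$ (a rational function $h$ with $\operatorname{div} h=2\eta$). Put $V=H^0(C,\Omega_C)$ and $W=H^0(C,\Omega_C(\eta))$, of dimensions $4$ and $3$. Let $$V_{C,\eta}=S^2W\times_{H^0(\Omega_C^{\otimes 2})}S^2V ,$$ the fibre product with respect to multiplication (for $S^2W$ followed by $\Omega_C(\eta)^{\otimes 2}\cong\Omega_C^{\otimes 2}$), let $\varphi\colon V_{C,\eta}\to S^2W$ (Lehavi's map) be the first projection and $V_{C,\eta}\to S^2V$ the second projection. Let $Q\in S^2V$ be the canonical quadric: the image of a generator of $\ker\varphi$, i.e. of the space of quadratic forms vanishing on the canonical curve $C\subset\mathbb P(V)\cong\mathbb P^3$. The map $\psi\colon S^2W\to S^2V$ is defined as follows. Let $\phi_\eta\colon C\to\mathbb P(W)\cong\mathbb P^2$ be the Prym canonical map. (a) Suppose $\phi_\eta$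 is birational onto a plane sextic. Let $b_1\colon S\to\mathbb P^2$ be the repeated blow-up resolving the sextic, with total exceptional divisors $E_j$ and multiplicities $r_j$. The linear system $b_1^*\mathcal O(3)\otimes\mathcal O_S(-\sum (r_j-1)E_j)=\mathcal O_S(K_S+C)$, whose sections are identified with $V$ by the residue along $C$, defines $b_2\colon S\to\mathbb P(V)$ with image $\Gamma_\eta$. Assume that no quadric contains $\Gamma_\eta$ (so that $\Gamma_\eta$ is a cubic surface). There is a section $n$ of $b_2^*\mathcal O(2)\otimes b_1^*\mathcal O(-2)$ such that for each $q\in S^2W$ there is a unique $\psi(q)\in S^2V$ with $b_2^*\psi(q)=n\cdot b_1^*q$ (thus $\psi(q)$ cuts out on $\Gamma_\eta$ the image of the conic $q=0$); the scalar in $n$ is fixed by requiring that multiplication by $n$ restricts on $C$ to the chosen isomorphism $\Omega_C(\eta)^{\otimes 2}\cong\Omega_C^{\otimes 2}$. (b) Suppose $\phi_\eta$ has degree two onto a plane cubic $E$ (the bielliptic case). Let $p\in\mathbb P(V)$ be the common zero of the differentials in $V$ that are anti-invariant under the involution of $C/E$. Then $\psi(q)$ is the quadratic form singular at $p$ whose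 restriction to $C$ is the section $q|_C$ of $\Omega_C(\eta)^{\otimes 2}\cong\Omega_C^{\otimes 2}$. For a linear map $\rho\colon S^2W\to S^2V$ let $G_\rho$ be the sextic form on $V^\vee$ given by $$V^\vee\to S^2(V^\vee)\cong(S^2V)^\vee\xrightarrow{\ \rho^\vee\ }(S^2W)^\vee\cong S^2(W^\vee)\xrightarrow{\ \mathrm{disc}\ }k,\qquad x\mapsto x\otimes x\mapsto\cdots ,$$ where $\mathrm{disc}$ is the determinant of the symmetric $3\times 3$ matrix; explicitly $G_\rho=\det\big(\rho(w_iw_j)\big)_{i,j}$ for a basis $w_0,w_1,w_2$ of $W$. Let $G=G_\psi$. Let $\widetilde\psi\colon S^2W\to V_{C,\eta}$ be any linear map with $\varphi\circ\widetilde\psi=\mathrm{id}$, and let $\widetilde G$ be the sextic attached to its composition with $V_{C,\eta}\to S^2V$. Then $$G\equiv\widetilde G\mod Q .$$ Moreover there is a cubic form $\gamma$ on $V^\vee$ with $\gamma^2\equiv\widetilde G\bmod Q$, and every cubic form $\gamma$ with $\gamma^2\equiv\widetilde G\bmod Q$ vanishes on $C$ and is not a multiple of $Q$. -/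

import Mathlib

open MvPolynomial KaehlerDifferential

/-!  Smooth projective curves over an algebraically closed field `k` are handled through their
function fields `F`: the points of the curve are the discrete valuation rings of `F` over `k`. -/

noncomputable section

namespace PrymCurve

section Curves

variable (k F : Type*) [Field k] [Field F] [Algebra k F]

/-- `F` is the function field of a curve over `k`: finite over `k(t)` for some transcendental `t`. -/
def IsCurveField : Prop :=
  ∃ t : F, Transcendental k t ∧ FiniteDimensional (IntermediateField.adjoin k {t}) F

/-- A point of the smooth projective curve with function field `F`, given by its local ring. -/
structure Place where
  ring : ValuationSubring F
  algebraMap_mem : ∀ c : k, algebraMap k F c ∈ ring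
  isDVR : IsDiscreteValuationRing ring

/-- Divisors on the curve. -/
abbrev CurveDivisor := Place k F →₀ ℤ

variable {k F}

/-- `ord_P g = n`. -/
def Place.HasOrd (P : Place k F) (g : F) (n : ℤ) : Prop :=
  ∃ (t : P.ring) (u : P.ringˣ), Irreducible t ∧ g = ((u : P.ring) : F) * (t : F) ^ n

/-- `div g = D`. -/
def IsDivisorOf (g : F) (D : CurveDivisor k F) : Prop :=
  g ≠ 0 ∧ ∀ P : Place k F, P.HasOrd g (D P)

/-- `D` is a principal divisor, i.e. its class in the Picard group is trivial. -/
def IsPrincipalDivisor (D : CurveDivisor k F) : Prop := ∃ g : F, IsDivisorOf g D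

/-- The rational differentials that are regular at `P`: the `O_P`-module generated by the
differentials `da` with `a ∈ O_P`. -/
def Place.regularForms (P : Place k F) : Submodule k Ω[F⁄k] :=
  Submodule.span k {θ | ∃ f ∈ P.ring, ∃ a ∈ P.ring, θ = f • D k F a}

/-- `H⁰(C, Ω_C(D))`, the rational differentials `θ` with `div θ + D ≥ 0`. -/
def H0 (D : CurveDivisor k F) : Submodule k Ω[F⁄k] where
  carrier := {θ | ∀ (P : Place k F) (t : P.ring), Irreducible t →
    ((t : F) ^ (D P)) • θ ∈ P.regularForms}
  add_mem' := by
    intro a b ha hb P t ht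
    rw [smul_add]
    exact Submodule.add_mem _ (ha P t ht) (hb P t ht)
  zero_mem' := by
    intro P t _
    rw [smul_zero]
    exact Submodule.zero_mem _
  smul_mem' := by
    intro c a ha P t ht
    rw [smul_comm]
    exact Submodule.smul_mem _ c (ha P t ht)

variable (k F)

/-- The genus `dim H⁰(C, Ω_C)`. -/
def genus : ℕ := Module.finrank k (H0 (0 : CurveDivisor k F))

/-- The curve has a map of degree two to the projective line. -/
def IsHyperelliptic : Prop :=
  ∃ t : F, Module.finrank (IntermediateField.adjoin k {t}) F = 2

end Curves

section QuadraticForms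

variable (k : Type*) [Field k]

/-- Quadratic forms in `n` variables: the symmetric square of an `n`-dimensional vector space with
a chosen basis. -/
abbrev Quad (n : ℕ) : Submodule k (MvPolynomial (Fin n) k) := homogeneousSubmodule (Fin n) k 2

variable {k}

/-- The product `wᵢ wⱼ` in the symmetric square. -/
def mono {n : ℕ} (i j : Fin n) : Quad k n :=
  ⟨X i * X j, (mem_homogeneousSubmodule _ _).2 ((isHomogeneous_X k i).mul (isHomogeneous_X k j))⟩

/-- The polynomial map `V^∨ → S²(V^∨) ≅ (S²V)^∨`, `p ↦ p ⊗ p`: the functional `q ↦ q(p)`. -/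
def veronese {n : ℕ} (p : Fin n → k) : Module.Dual k (Quad k n) :=
  (aeval p).toLinearMap ∘ₗ (Quad k n).subtype

/-- The discriminant of a functional on `S²W` under `(S²W)^∨ ≅ S²(W^∨)`: the determinant of the
symmetric matrix of its values on the products `wᵢ wⱼ`. -/
def disc (l : Module.Dual k (Quad k 3)) : k := (Matrix.of fun i j => l (mono i j)).det

/-- The form `G` attached to a linear map `ψ : S²W → S²V`, as a polynomial on `V^∨`: the composition
of `p ↦ p ⊗ p` with the dual of `ψ` and with the discriminant; see `eval_sextic`. -/
def sextic (ψ : Quad k 3 →ₗ[k] Quad k 4) : MvPolynomial (Fin 4) k :=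
  (Matrix.of fun i j => (ψ (mono i j) : MvPolynomial (Fin 4) k)).det

theorem eval_sextic (ψ : Quad k 3 →ₗ[k] Quad k 4) (p : Fin 4 → k) :
    eval p (sextic ψ) = disc (ψ.dualMap (veronese p)) := by
  rw [sextic, disc, RingHom.map_det]
  congr 1

end QuadraticForms

section Prym

variable {k F : Type*} [Field k] [Field F] [Algebra k F]

/-- The family `v` is a basis of the space `S` of differentials. -/
def IsBasisOf {n : ℕ} (v : Fin n → Ω[F⁄k]) (S : Submodule k Ω[F⁄k]) : Prop :=
  LinearIndependent k v ∧ Submodule.span k (Set.range v) = S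

/-- For differentials `v₀, …, vₙ₋₁`, the restriction to the curve of a form of degree `d` in `n`
variables, `P ↦ P(v₀, …, vₙ₋₁)`, a rational section of `Ω_C^{⊗ d}`. The rational sections of all
`Ω_C^{⊗ d}` are collected in the symmetric algebra of the `F`-vector space `Ω_F`. -/
def restrict {n : ℕ} (v : Fin n → Ω[F⁄k]) :
    MvPolynomial (Fin n) k →ₐ[k] SymmetricAlgebra F Ω[F⁄k] :=
  aeval fun i => SymmetricAlgebra.ι F Ω[F⁄k] (v i)

/-- `V_{C,η}`, the fibre product of `S²H⁰(Ω_C(η))` and `S²H⁰(Ω_C)` over the quadratic differentials.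
Here `x` and `w` are bases of `H⁰(Ω_C)` and `H⁰(Ω_C(η))`, and a function `h` with divisor `2η` gives
the isomorphism `Ω_C(η)^{⊗ 2} ≅ Ω_C^{⊗ 2}`. -/
def lehaviSpace (x : Fin 4 → Ω[F⁄k]) (w : Fin 3 → Ω[F⁄k]) (h : F) :
    Submodule k (Quad k 3 × Quad k 4) where
  carrier := {z | h • restrict w z.1 = restrict x z.2}
  add_mem' := by
    intro a b ha hb
    simp only [Set.mem_ofPred_eq, Prod.fst_add, Prod.snd_add, Submodule.coe_add, map_add,
      smul_add] at *
    rw [ha, hb]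
  zero_mem' := by simp
  smul_mem' := by
    intro c a ha
    simp only [Set.mem_ofPred_eq, Prod.smul_fst, Prod.smul_snd, Submodule.coe_smul, map_smul] at *
    rw [smul_comm, ha]

/-- Lehavi's map `φ : V_{C,η} → S²H⁰(Ω_C(η))`, the first projection. -/
def lehaviMap (x : Fin 4 → Ω[F⁄k]) (w : Fin 3 → Ω[F⁄k]) (h : F) :
    lehaviSpace x w h →ₗ[k] Quad k 3 :=
  LinearMap.fst k (Quad k 3) (Quad k 4) ∘ₗ (lehaviSpace x w h).subtype

/-- The inclusion `V_{C,η} → S²H⁰(Ω_C)`, the second projection. -/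
def lehaviIncl (x : Fin 4 → Ω[F⁄k]) (w : Fin 3 → Ω[F⁄k]) (h : F) :
    lehaviSpace x w h →ₗ[k] Quad k 4 :=
  LinearMap.snd k (Quad k 3) (Quad k 4) ∘ₗ (lehaviSpace x w h).subtype

/-- `f` is an equation of degree `d` of the Prym canonical curve, the image of the map
`C → ℙ²` given by `w`: it generates the ideal of all forms vanishing on that curve. -/
def IsPrymCanonicalEquation (w : Fin 3 → Ω[F⁄k]) (d : ℕ) (f : MvPolynomial (Fin 3) k) : Prop :=
  f.IsHomogeneous d ∧ RingHom.ker (restrict w) = Ideal.span {f}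

/-- The numerator `wᵢ dwⱼ - wⱼ dwᵢ = wᵢ² d(wⱼ / wᵢ)` of the Poincaré residue, where `g = wⱼ / wᵢ`. -/
def resNum (v : Ω[F⁄k]) (g : F) : SymmetricAlgebra F Ω[F⁄k] :=
  SymmetricAlgebra.ι F Ω[F⁄k] v ^ 2 * SymmetricAlgebra.ι F Ω[F⁄k] (D k F g)

/-- The adjoint cubics `a₀, …, a₃` that define the rational map `ℙ² ⇢ ℙ³`. Let `S → ℙ²` be the
blow-up that resolves the plane sextic `f = 0`, with total exceptional divisors `Eⱼ` and
multiplicities `rⱼ`. Since `3H - ∑ (rⱼ - 1) Eⱼ = K_S + C`, its sections, the adjoint cubics, are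
identified with `H⁰(Ω_C)` by the Poincaré residue along `C`; `aₘ` is the cubic with residue `xₘ`:
`xₘ = aₘ · (wᵢ dwᵢ₊₁ - wᵢ₊₁ dwᵢ) / (∂f/∂wᵢ₊₂)`, indices mod 3. -/
def IsAdjointBasis (x : Fin 4 → Ω[F⁄k]) (w : Fin 3 → Ω[F⁄k]) (f : MvPolynomial (Fin 3) k)
    (a : Fin 4 → MvPolynomial (Fin 3) k) : Prop :=
  ∀ m, (a m).IsHomogeneous 3 ∧ ∀ (i : Fin 3) (g : F), w (i + 1) = g • w i →
    SymmetricAlgebra.ι F Ω[F⁄k] (x m) * restrict w (pderiv (i + 2) f) =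
      restrict w (a m) * resNum (w i) g

/-- The map `ψ` when the Prym canonical map is birational onto a plane sextic `f = 0`.
Let `c : ℙ² ⇢ Γ_η ⊆ ℙ³` be given by the adjoint cubics `a`. It is part of the situation that no
quadric contains the surface `Γ_η`. The quadric `ψ(q)` cuts out the image of the conic `q` under `c`:
its pull-back is `n · q`, where the quartic `n` (as a section of `b₂^*𝒪(2) ⊗ b₁^*𝒪(-2)` on the
blow-up) is the equation of the curves contracted by `c`. The scalar in `n` is fixed by asking that
the isomorphism `b₁^*𝒪(2) ≅ b₂^*𝒪(2)(-∑ Nᵢ)` defined by `n` restricts on `C` to the isomorphism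
`Ω_C(η)^{⊗ 2} ≅ Ω_C^{⊗ 2}` defined by `h`. -/
def IsPsiBirational (x : Fin 4 → Ω[F⁄k]) (w : Fin 3 → Ω[F⁄k]) (h : F)
    (ψ : Quad k 3 →ₗ[k] Quad k 4) : Prop :=
  ∃ (f n : MvPolynomial (Fin 3) k) (a : Fin 4 → MvPolynomial (Fin 3) k),
    IsPrymCanonicalEquation w 6 f ∧ IsAdjointBasis x w f a ∧
    (∀ P ∈ Quad k 4, aeval a P = 0 → P = 0) ∧
    n.IsHomogeneous 4 ∧
    (∀ (i : Fin 3) (g : F), w (i + 1) = g • w i →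
      restrict w n * resNum (w i) g ^ 2 = h • restrict w (pderiv (i + 2) f) ^ 2) ∧
    ∀ q : Quad k 3, aeval a (ψ q : MvPolynomial (Fin 4) k) = n * (q : MvPolynomial (Fin 3) k)

/-- The function field of the Prym canonical curve, generated by the quotients of the `wᵢ`. -/
def prymField (w : Fin 3 → Ω[F⁄k]) : IntermediateField k F :=
  IntermediateField.adjoin k {g | ∃ i j, w i = g • w j}

/-- For a subfield `E` of `F` of index two, corresponding to a double cover `π : C → E`, the point
`p` of `V^∨` spans the line that corresponds to the `π`-invariant part of
`V = H⁰(Ω_C)`: it is nonzero and annihilates every anti-invariant form. These are the forms `y · π^*θ`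
with `θ` a differential on `E`, where `F = E(y)`, `y² ∈ E`. -/
def IsVertex (E : IntermediateField k F) (x : Fin 4 → Ω[F⁄k]) (p : Fin 4 → k) : Prop :=
  p ≠ 0 ∧ ∃ y : F, y ∉ E ∧ y ^ 2 ∈ E ∧ ∀ c : Fin 4 → k,
    (∃ θ : Ω[E⁄k], ∑ i, c i • x i = y • KaehlerDifferential.map k k E F θ) → ∑ i, c i * p i = 0

/-- The map `ψ` in the bielliptic case, where the Prym canonical map has degree two onto a plane
cubic `E`. Then `Γ_η` is the cone over `E` with vertex `p`, and `ψ(q)` is the quadric cone with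
vertex `p` that cuts out on `C` the same section of `Ω_C^{⊗ 2} ≅ Ω_C(η)^{⊗ 2}` as the conic `q`. -/
def IsPsiBielliptic (x : Fin 4 → Ω[F⁄k]) (w : Fin 3 → Ω[F⁄k]) (h : F)
    (ψ : Quad k 3 →ₗ[k] Quad k 4) : Prop :=
  ∃ (f : MvPolynomial (Fin 3) k) (p : Fin 4 → k),
    IsPrymCanonicalEquation w 3 f ∧ Module.finrank (prymField w) F = 2 ∧
    IsVertex (prymField w) x p ∧
    ∀ q : Quad k 3, (∀ i, eval p (pderiv i (ψ q : MvPolynomial (Fin 4) k)) = 0) ∧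
      restrict x (ψ q : MvPolynomial (Fin 4) k) = h • restrict w (q : MvPolynomial (Fin 3) k)

/-- The geometric map `ψ : S²H⁰(Ω_C(η)) → S²H⁰(Ω_C)`, in both cases. -/
def IsPsi (x : Fin 4 → Ω[F⁄k]) (w : Fin 3 → Ω[F⁄k]) (h : F)
    (ψ : Quad k 3 →ₗ[k] Quad k 4) : Prop :=
  IsPsiBirational x w h ψ ∨ IsPsiBielliptic x w h ψ

end Prym

end PrymCurve

end

/-!
The symmetric algebra of the one-dimensional `F`-space `Ω_F` is a polynomial ring `F[T]`, so forms
restrict to the curve with values in a domain.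

*The congruence.* In both cases `ψ(q)` restricts to `h q` on the curve. In the bielliptic case
this is part of the definition of `ψ`; for a sextic `f`, it follows from the Poincaré residue and
the normalization of `n`, after multiplication by the square of a partial derivative of `f` that
does not vanish on the curve (`restrict_eq_of_adjoint`; such a derivative exists because `f` is
prime and `k` is perfect). The lift of `q` to the fibre product has the same restriction, so that
the entries of the matrices `ψ(wᵢ wⱼ)` and `ψ'(wᵢ wⱼ)`, and hence their determinants, agree modulo
the canonical quadric `Q`.

*The square.* The symmetric matrix `M = (ψ(wᵢ wⱼ))` of quadratic forms has rank one along the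
surface `Γ_η`: there it is `n wᵢ wⱼ`. The surface is irreducible of dimension two, so its ideal is
generated by a prime `γ` (`exists_prime_ker_eq_span`), which divides the `2 × 2` minors. Then
`adj M = γ N` and `(det M)² = γ³ det N`, whence `det M = c γ²` with `γ` a cubic form, since no quadric
contains `Γ_η` (`det_eq_C_mul_sq`). Two degenerations have to be excluded. If `det M = 0` but
`adj M ≠ 0`, then `M` has a constant vector in its kernel, which contradicts the independence of the
`wᵢ`. If `adj M = 0`, then the diagonal entries of `M` are squares
(`isSquare_of_adjugate_eq_zero`), so that `h` is a square in `F` and `η` is principal.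

In the bielliptic case the forms `ψ(q)` are singular at `p`, hence come from the plane to which
the curve is projected from `p`, and the same argument applies to the image of the curve there.
This image is not a conic: otherwise the quotients of its coordinates are in a field `k(t)` which
contains the function field of the Prym canonical curve, so that `F` has degree one or two over
`k(t)` and the curve is hyperelliptic (`IsCurveField.restrict_ne_zero_of_bielliptic`).

*The remaining claim.* A cubic form with square `det M'` modulo `Q` vanishes on the curve because
`M'` restricts to the matrix `h wᵢ wⱼ` of rank one. If it were a multiple of `Q`, then `Q` would
divide `c γ²`, which is impossible for a quadratic form `Q` and a prime cubic form `γ`.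
-/

namespace PrymCurve

/-! ### Forms in a polynomial ring and their divisors -/

section Forms

variable {σ R : Type*} [CommRing R]

/-- The substitution `Xᵢ ↦ Xᵢ T`, which separates the homogeneous components. -/
noncomputable def gradingHom : MvPolynomial σ R →ₐ[R] Polynomial (MvPolynomial σ R) :=
  aeval fun i => Polynomial.C (X i) * Polynomial.X

theorem gradingHom_monomial (m : σ →₀ ℕ) (r : R) :
    gradingHom (monomial m r) = Polynomial.C (monomial m r) * Polynomial.X ^ m.degree := by
  rw [gradingHom, aeval_monomial, Finsupp.prod]
  simp only [mul_pow, Finset.prod_mul_distrib, Finset.prod_pow_eq_pow_sum]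
  rw [← mul_assoc, monomial_eq, Finsupp.prod, Finsupp.degree_apply]
  simp [Polynomial.algebraMap_apply, MvPolynomial.algebraMap_eq, -prod_X_pow_eq_monomial]

theorem coeff_gradingHom (p : MvPolynomial σ R) (d : ℕ) :
    (gradingHom p).coeff d = homogeneousComponent d p := by
  classical
  induction p using MvPolynomial.induction_on' with
  | monomial m r =>
    rw [gradingHom_monomial, Polynomial.coeff_C_mul_X_pow]
    rw [homogeneousComponent_of_mem (isHomogeneous_monomial r (n := m.degree) rfl)]
  | add p q hp hq => rw [map_add, Polynomial.coeff_add, hp, hq, map_add]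

theorem gradingHom_of_isHomogeneous {p : MvPolynomial σ R} {d : ℕ} (hp : p.IsHomogeneous d) :
    gradingHom p = Polynomial.C p * Polynomial.X ^ d := by
  ext1 i
  rw [coeff_gradingHom, Polynomial.coeff_C_mul_X_pow, homogeneousComponent_of_mem hp]

/-- A divisor of a nonzero form over a domain is a form. -/
theorem isHomogeneous_of_mul [IsDomain R] {p q : MvPolynomial σ R} {N : ℕ}
    (h : (p * q).IsHomogeneous N) (h0 : p * q ≠ 0) : p.IsHomogeneous p.totalDegree := by
  have hinj : ∀ f : MvPolynomial σ R, gradingHom f = 0 → f = 0 := fun f hf => by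
    rw [← sum_homogeneousComponent f]
    exact Finset.sum_eq_zero fun i _ => by rw [← coeff_gradingHom, hf, Polynomial.coeff_zero]
  have hp : gradingHom p ≠ 0 := fun h => h0 (by rw [hinj p h, zero_mul])
  have hq : gradingHom q ≠ 0 := fun h => h0 (by rw [hinj q h, mul_zero])
  have e := gradingHom_of_isHomogeneous h
  rw [map_mul] at e
  have e1 := congrArg Polynomial.natDegree e
  have e2 := congrArg Polynomial.natTrailingDegree e
  rw [Polynomial.natDegree_mul hp hq, Polynomial.natDegree_C_mul_X_pow _ _ h0] at e1
  rw [Polynomial.natTrailingDegree_mul hp hq,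
    Polynomial.natTrailingDegree_mul (by simpa using h0) (by simp)] at e2
  have i1 := Polynomial.natTrailingDegree_le_natDegree (gradingHom p)
  have i2 := Polynomial.natTrailingDegree_le_natDegree (gradingHom q)
  simp only [Polynomial.natTrailingDegree_C, Polynomial.natTrailingDegree_X_pow] at e2
  set d := (gradingHom p).natDegree
  have key : p = homogeneousComponent d p := by
    conv_lhs => rw [← sum_homogeneousComponent p]
    by_cases hd : d ∈ Finset.range (p.totalDegree + 1)
    · refine Finset.sum_eq_single_of_mem d hd fun i _ hi => ?_
      rw [← coeff_gradingHom]
      rcases lt_or_gt_of_ne hi with hi | hi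
      · exact Polynomial.coeff_eq_zero_of_lt_natTrailingDegree (by omega)
      · exact Polynomial.coeff_eq_zero_of_natDegree_lt hi
    · exfalso
      apply hp
      rw [← Polynomial.leadingCoeff_eq_zero, Polynomial.leadingCoeff, coeff_gradingHom]
      exact homogeneousComponent_eq_zero _ _ (by rw [Finset.mem_range] at hd; omega)
  have hd : p.IsHomogeneous d := by
    rw [key]; exact homogeneousComponent_isHomogeneous _ _
  rwa [hd.totalDegree (fun h => h0 (by rw [h, zero_mul]))]

theorem isHomogeneous_of_dvd [IsDomain R] {p f : MvPolynomial σ R} {N : ℕ}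
    (hf : f.IsHomogeneous N) (h0 : f ≠ 0) (h : p ∣ f) : p.IsHomogeneous p.totalDegree := by
  obtain ⟨q, rfl⟩ := h
  exact isHomogeneous_of_mul hf h0

end Forms

section Field

variable {σ k : Type*} [Field k]

/-- If `s` is squarefree and divides the squares of elements `tⱼ` of at most the same degree, then
the `tⱼ` are constant multiples of `s`. -/
theorem exists_eq_C_mul_of_squarefree {ι : Type*} {s : MvPolynomial σ k} (t : ι → MvPolynomial σ k)
    (hs : Squarefree s) (hdvd : ∀ j, s ∣ t j ^ 2)
    (hdeg : ∀ j, (t j).totalDegree ≤ s.totalDegree) : ∃ c : ι → k, ∀ j, t j = C (c j) * s := by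
  have h0 : s ≠ 0 := hs.ne_zero
  have key : ∀ j, ∃ c : k, t j = C c * s := fun j => by
    obtain ⟨u, hu⟩ := (hs.dvd_pow_iff_dvd two_ne_zero).1 (hdvd j)
    by_cases hu0 : u = 0
    · exact ⟨0, by rw [hu, hu0]; simp⟩
    have hd := hdeg j
    rw [hu, totalDegree_mul_of_isDomain h0 hu0] at hd
    have : u.totalDegree = 0 := by omega
    rw [totalDegree_eq_zero_iff_eq_C] at this
    exact ⟨_, by rw [hu, mul_comm, ← this]⟩
  choose c hc using key
  exact ⟨c, hc⟩

theorem isUnit_iff_totalDegree {p : MvPolynomial σ k} : IsUnit p ↔ p ≠ 0 ∧ p.totalDegree = 0 := by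
  constructor
  · rintro h
    refine ⟨h.ne_zero, ?_⟩
    obtain ⟨q, hq⟩ := h.exists_right_inv
    have := congrArg totalDegree hq
    rw [totalDegree_mul_of_isDomain h.ne_zero (right_ne_zero_of_mul_eq_one hq)] at this
    simp at this
    omega
  · rintro ⟨h, h0⟩
    rw [totalDegree_eq_zero_iff_eq_C] at h0
    rw [h0] at h ⊢
    exact (isUnit_iff_ne_zero.2 fun h1 => h (by rw [h1, C_0])).map C

theorem squarefree_of_totalDegree_le_one {p : MvPolynomial σ k} (h0 : p ≠ 0)
    (h1 : p.totalDegree ≤ 1) : Squarefree p := by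
  rintro s ⟨u, rfl⟩
  have hs : s ≠ 0 := by rintro rfl; simp at h0
  have hu : u ≠ 0 := by rintro rfl; simp at h0
  rw [totalDegree_mul_of_isDomain (mul_ne_zero hs hs) hu, totalDegree_mul_of_isDomain hs hs] at h1
  exact isUnit_iff_totalDegree.2 ⟨hs, by omega⟩

theorem isSquare_or_squarefree_of_totalDegree_le_two [IsAlgClosed k] {p : MvPolynomial σ k}
    (h0 : p ≠ 0) (h2 : p.totalDegree ≤ 2) : IsSquare p ∨ Squarefree p := by
  refine or_iff_not_imp_right.2 fun h => ?_
  simp only [Squarefree, not_forall] at h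
  obtain ⟨s, ⟨u, rfl⟩, hs⟩ := h
  have hs0 : s ≠ 0 := by rintro rfl; simp at h0
  have hu : u ≠ 0 := by rintro rfl; simp at h0
  rw [totalDegree_mul_of_isDomain (mul_ne_zero hs0 hs0) hu, totalDegree_mul_of_isDomain hs0 hs0]
    at h2
  have hsd : s.totalDegree ≠ 0 := fun h => hs (isUnit_iff_totalDegree.2 ⟨hs0, h⟩)
  have hud : u.totalDegree = 0 := by omega
  rw [totalDegree_eq_zero_iff_eq_C] at hud
  obtain ⟨c, hc⟩ := IsAlgClosed.exists_pow_nat_eq (coeff 0 u) (zero_lt_two)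
  refine ⟨s * C c, ?_⟩
  rw [hud, ← hc, C_pow]
  ring

/-! ### Symmetric matrices of quadratic forms -/

/-- The `2 × 2` minors of a symmetric `3 × 3` matrix with vanishing adjugate. -/
theorem mul_eq_of_adjugate_eq_zero {A : Type*} [CommRing A] {M : Matrix (Fin 3) (Fin 3) A}
    (hM : M.IsSymm) (h : M.adjugate = 0) (i j l : Fin 3) : M i j * M i l = M i i * M j l := by
  have h10 : M 1 0 = M 0 1 := hM.apply 0 1
  have h20 : M 2 0 = M 0 2 := hM.apply 0 2
  have h21 : M 2 1 = M 1 2 := hM.apply 1 2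
  have e (a b : Fin 3) : M.adjugate a b = 0 := congrFun (congrFun h a) b
  rw [Matrix.adjugate_fin_three] at e
  have e0 := e 0 0
  have e1 := e 1 1
  have e2 := e 2 2
  have e3 := e 0 1
  have e4 := e 0 2
  have e5 := e 1 2
  simp [-mul_eq_mul_left_iff, h10, h20, h21] at e0 e1 e2 e3 e4 e5
  clear e h
  fin_cases i <;> fin_cases j <;> fin_cases l <;>
    simp only [Fin.zero_eta, Fin.mk_one, Fin.reduceFinMk, h10, h20, h21] <;>
    first
    | exact mul_comm _ _
    | linear_combination -e0
    | linear_combination -e1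
    | linear_combination -e2
    | linear_combination e3
    | linear_combination e4
    | linear_combination e5

theorem sq_eq_of_adjugate_eq_zero {A : Type*} [CommRing A] {M : Matrix (Fin 3) (Fin 3) A}
    (hM : M.IsSymm) (h : M.adjugate = 0) (i j : Fin 3) : M i j ^ 2 = M i i * M j j := by
  rw [sq, mul_eq_of_adjugate_eq_zero hM h]

/-- If the adjugate of a nonzero symmetric matrix `N` over a domain vanishes, then some diagonal
entry of `N` is nonzero. -/
theorem exists_diag_ne_zero {A : Type*} [CommRing A] [IsDomain A] {N : Matrix (Fin 3) (Fin 3) A}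
    (hN : N.IsSymm) (h : N.adjugate = 0) (h0 : N ≠ 0) : ∃ i, N i i ≠ 0 := by
  by_contra! hc
  refine h0 (Matrix.ext fun i j => ?_)
  have := sq_eq_of_adjugate_eq_zero hN h i j
  rw [hc i, zero_mul] at this
  exact pow_eq_zero_iff two_ne_zero |>.1 this

/-- If a symmetric matrix of quadratic forms has rank one and no constant vector in its kernel, then
its diagonal entries are squares: otherwise the first row would be a multiple of a constant row. -/
theorem isSquare_of_adjugate_eq_zero [IsAlgClosed k] {M : Matrix (Fin 3) (Fin 3) (MvPolynomial σ k)}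
    (hM : M.IsSymm) (hdeg : ∀ i j, (M i j).IsHomogeneous 2)
    (hker : ∀ v : Fin 3 → k, M.mulVec (fun i => C (v i)) = 0 → v = 0) (h : M.adjugate = 0)
    (i : Fin 3) : IsSquare (M i i) := by
  have hsq := sq_eq_of_adjugate_eq_zero hM h
  by_cases h0 : M i i = 0
  · rw [h0]; exact .zero
  refine (isSquare_or_squarefree_of_totalDegree_le_two h0 (hdeg i i).totalDegree_le).resolve_right
    fun hs => ?_
  obtain ⟨c, hc⟩ := exists_eq_C_mul_of_squarefree (M i) hs (fun j => ⟨_, hsq i j⟩)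
    (fun j => by rw [(hdeg i i).totalDegree h0]; exact (hdeg i j).totalDegree_le)
  -- row `i` is `mᵢᵢ • c`, hence row `j` is `cⱼ mᵢᵢ • c`, and every vector orthogonal to `c` is in
  -- the kernel
  have hci : C (c i) = (1 : MvPolynomial σ k) :=
    mul_right_cancel₀ h0 (by rw [← hc i, one_mul])
  have hrow : ∀ j l, M j l = C (c j) * C (c l) * M i i := fun j l => by
    have := mul_eq_of_adjugate_eq_zero hM h i j l
    rw [hc j, hc l] at this
    refine mul_left_cancel₀ h0 ?_
    linear_combination -this
  have hv := hker (Pi.single (i + 1) 1 - Pi.single i (c (i + 1))) ?_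
  · have := congrFun hv (i + 1)
    rw [Pi.sub_apply, Pi.single_eq_same, Pi.single_eq_of_ne (by simp)] at this
    simp at this
  · have : (fun j => C ((Pi.single (i + 1) 1 - Pi.single i (c (i + 1)) : Fin 3 → k) j)) =
        (Pi.single (i + 1) 1 - Pi.single i (C (c (i + 1))) : Fin 3 → MvPolynomial σ k) := by
      funext j
      simp [Pi.single_apply, apply_ite C]
    rw [this, Matrix.mulVec_sub]
    funext l
    simp only [Matrix.mulVec_single, Pi.sub_apply, Pi.smul_apply, Matrix.col_apply,
      MulOpposite.smul_eq_mul_unop, MulOpposite.unop_op, hrow l, hci, Pi.zero_apply]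
    ring

theorem isHomogeneous_adjugate {M : Matrix (Fin 3) (Fin 3) (MvPolynomial σ k)}
    (hdeg : ∀ i j, (M i j).IsHomogeneous 2) (i j : Fin 3) : (M.adjugate i j).IsHomogeneous 4 := by
  have hm (a b c d : Fin 3) : (M a b * M c d).IsHomogeneous 4 := (hdeg a b).mul (hdeg c d)
  rw [Matrix.adjugate_fin_succ_eq_det_submatrix, Matrix.det_fin_two]
  have h1 : ((-1 : MvPolynomial σ k) ^ (j + i : ℕ)) = C ((-1) ^ (j + i : ℕ)) := by simp
  rw [h1]
  exact ((hm _ _ _ _).sub (hm _ _ _ _)).C_mul _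

theorem isHomogeneous_det {M : Matrix (Fin 3) (Fin 3) (MvPolynomial σ k)}
    (hdeg : ∀ i j, (M i j).IsHomogeneous 2) : M.det.IsHomogeneous 6 := by
  have hm (a b c d e f : Fin 3) : (M a b * M c d * M e f).IsHomogeneous 6 :=
    ((hdeg a b).mul (hdeg c d)).mul (hdeg e f)
  rw [Matrix.det_fin_three]
  refine .sub (.add (.add (.sub (.sub ?_ ?_) ?_) ?_) ?_) ?_ <;> exact hm _ _ _ _ _ _

/-- Let `M` be a symmetric matrix of quadratic forms whose `2 × 2` minors are divisible by a prime
`γ` of degree at least three and do not all vanish. If no constant vector is in the kernel of `M`,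
then `γ` is a cubic form and `det M` is a nonzero multiple of `γ²`.

With `adj M = γ N`, the determinant satisfies `(det M)² = γ³ det N`. Hence `γ² ∣ det M`, and the
degrees leave a constant cofactor, provided that `det M ≠ 0`. If `det M = 0`, then `N` has rank one
and entries of degree at most one, and its rows, which are in the kernel of `M`, are multiples of
a constant vector. -/
theorem det_eq_C_mul_sq {M : Matrix (Fin 3) (Fin 3) (MvPolynomial σ k)}
    (hM : M.IsSymm) (hdeg : ∀ i j, (M i j).IsHomogeneous 2)
    (hker : ∀ v : Fin 3 → k, M.mulVec (fun i => C (v i)) = 0 → v = 0) (h : M.adjugate ≠ 0)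
    {γ : MvPolynomial σ k} (hγ : Prime γ) (hdvd : ∀ i j, γ ∣ M.adjugate i j)
    (h3 : 3 ≤ γ.totalDegree) : γ.IsHomogeneous 3 ∧ ∃ c : k, c ≠ 0 ∧ M.det = C c * γ ^ 2 := by
  have hγ0 : γ ≠ 0 := hγ.ne_zero
  obtain ⟨N, hadj⟩ : ∃ N : Matrix (Fin 3) (Fin 3) (MvPolynomial σ k), M.adjugate = γ • N := by
    choose N hN using hdvd
    exact ⟨Matrix.of N, Matrix.ext fun i j => hN i j⟩
  have hN (i j) : M.adjugate i j = γ * N i j := congrFun (congrFun hadj i) j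
  have hN0 : N ≠ 0 := fun h' => h (by rw [hadj, h', smul_zero])
  have hdet : M.det ^ 2 = γ ^ 3 * N.det := by
    have := Matrix.det_adjugate M
    rw [hadj, Matrix.det_smul] at this
    simpa using this.symm
  have hsymmN : N.IsSymm := by
    have : M.adjugate.transpose = M.adjugate := by rw [Matrix.adjugate_transpose, hM.eq]
    rw [hadj, Matrix.transpose_smul] at this
    exact Matrix.ext fun i j => mul_left_cancel₀ hγ0 (congrFun (congrFun this i) j)
  have hadjdeg := isHomogeneous_adjugate hdeg
  have hNdeg : ∀ i j, N i j ≠ 0 → γ.totalDegree + (N i j).totalDegree = 4 := fun i j h0 => by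
    rw [← totalDegree_mul_of_isDomain hγ0 h0, ← hN i j]
    exact (hadjdeg i j).totalDegree (by rw [hN i j]; exact mul_ne_zero hγ0 h0)
  have hdet0 : M.det ≠ 0 := fun h0 => by
    have hMN : M * N = 0 := by
      have := M.mul_adjugate
      rw [hadj, h0, zero_smul, Matrix.mul_smul] at this
      exact (smul_eq_zero.1 this).resolve_left hγ0
    have hNadj : N.adjugate = 0 := by
      have := M.adjugate_adjugate (by simp)
      rw [hadj, h0, Matrix.adjugate_smul] at this
      simpa [hγ0] using this
    obtain ⟨i, hi⟩ := exists_diag_ne_zero hsymmN hNadj hN0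
    have hle : ∀ j, (N i j).totalDegree ≤ (N i i).totalDegree := fun j => by
      by_cases h' : N i j = 0
      · rw [h']; simp
      · have := hNdeg i j h'
        have := hNdeg i i hi
        omega
    obtain ⟨c, hc⟩ := exists_eq_C_mul_of_squarefree (N i)
      (squarefree_of_totalDegree_le_one hi (by have := hNdeg i i hi; omega))
      (fun j => ⟨_, sq_eq_of_adjugate_eq_zero hsymmN hNadj i j⟩) hle
    have hcz := hker c ?_
    · exact hi (by have := hc i; rwa [hcz, Pi.zero_apply, C_0, zero_mul] at this)
    · funext l
      refine mul_right_cancel₀ hi ?_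
      have := congrFun (congrFun hMN l) i
      rw [Matrix.mul_apply] at this
      rw [Pi.zero_apply, zero_mul, ← Matrix.zero_apply (α := MvPolynomial σ k) l i, ← this,
        Matrix.mulVec, dotProduct, Finset.sum_mul]
      refine Finset.sum_congr rfl fun j _ => ?_
      rw [← hsymmN.apply j i, hc j, mul_assoc]
  obtain ⟨d, hd⟩ : γ ∣ M.det := hγ.dvd_of_dvd_pow (hdet ▸ dvd_mul_of_dvd_left
    (dvd_pow_self γ three_ne_zero) _)
  obtain ⟨e, rfl⟩ : γ ∣ d := by
    refine hγ.dvd_of_dvd_pow (n := 2) ⟨N.det, ?_⟩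
    refine mul_left_cancel₀ (pow_ne_zero 2 hγ0) ?_
    rw [hd] at hdet
    linear_combination hdet
  have he0 : e ≠ 0 := by rintro rfl; simp [hd] at hdet0
  have hdet6 : M.det.totalDegree = 6 :=
    (isHomogeneous_det hdeg).totalDegree hdet0
  rw [hd, totalDegree_mul_of_isDomain hγ0 (mul_ne_zero hγ0 he0),
    totalDegree_mul_of_isDomain hγ0 he0] at hdet6
  have h3' : γ.totalDegree = 3 := by omega
  refine ⟨?_, coeff 0 e, ?_, ?_⟩
  · rw [← h3']
    obtain ⟨i, j, hij⟩ : ∃ i j, M.adjugate i j ≠ 0 := by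
      by_contra! hc
      exact h (Matrix.ext hc)
    exact isHomogeneous_of_dvd (hadjdeg i j) hij ⟨_, hN i j⟩
  all_goals
    have he : e.totalDegree = 0 := by omega
    rw [totalDegree_eq_zero_iff_eq_C] at he
  · intro h0
    rw [h0, C_0] at he
    exact he0 he
  · rw [← he, hd]; ring

end Field

/-! ### Algebraic independence and kernels of codimension one -/

section AlgebraicIndependence

variable {k : Type*} [Field k]

/-- Preimages of algebraically independent elements and a nonzero element of the kernel are
algebraically independent. -/
theorem algebraicIndependent_option {A B ι : Type*} [CommRing A] [IsDomain A] [CommRing B]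
    [Algebra k A] [Algebra k B] (φ : A →ₐ[k] B) {b : ι → A}
    (hb : AlgebraicIndependent k fun i => φ (b i)) {a : A} (ha : a ≠ 0) (hφ : φ a = 0) :
    AlgebraicIndependent k fun o : Option ι => o.elim a b := by
  have hb' : AlgebraicIndependent k b := AlgebraicIndependent.of_comp φ hb
  rw [hb'.option_iff_transcendental]
  intro halg
  obtain ⟨⟨r, hr⟩, hr0, c, hc⟩ := halg.exists_nonzero_dvd (mem_nonZeroDivisors_of_ne_zero ha)
  obtain ⟨P, hP⟩ : ∃ P, aeval b P = r := by
    rw [Algebra.adjoin_range_eq_range_aeval] at hr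
    exact hr
  refine hr0 (Subtype.ext ?_)
  have h1 : φ (aeval b P) = 0 := by
    rw [hP, show r = a * c from hc, map_mul, hφ, zero_mul]
  rw [← AlgHom.comp_apply, comp_aeval] at h1
  have : P = 0 := by
    rw [algebraicIndependent_iff] at hb
    exact hb P h1
  change r = 0
  rw [← hP, this, map_zero]

/-- A homomorphism from a polynomial ring in `n + 1` variables to a domain which is not injective
and has `n` algebraically independent elements in its image has a principal kernel. -/
theorem exists_prime_ker_eq_span {B : Type*} [CommRing B] [IsDomain B] [Algebra k B] {n : ℕ}
    (φ : MvPolynomial (Fin (n + 1)) k →ₐ[k] B) {b : Fin n → MvPolynomial (Fin (n + 1)) k}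
    (hb : AlgebraicIndependent k fun i => φ (b i)) {g : MvPolynomial (Fin (n + 1)) k} (hg : g ≠ 0)
    (hφ : φ g = 0) : ∃ γ, Prime γ ∧ RingHom.ker φ = Ideal.span {γ} := by
  have hprime : (RingHom.ker φ).IsPrime := RingHom.ker_isPrime φ
  obtain ⟨γ, hγ, hγp⟩ := Ideal.IsPrime.exists_mem_prime_of_ne_bot hprime
    (fun h => hg (by rwa [← Ideal.mem_bot, ← h]))
  refine ⟨γ, hγp, le_antisymm (fun p hp => ?_) ((Ideal.span_singleton_le_iff_mem _).2 hγ)⟩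
  have : (Ideal.span {γ}).IsPrime := (Ideal.span_singleton_prime hγp.ne_zero).2 hγp
  -- otherwise the kernel has height at least two, and `n + 2` elements are independent
  by_contra hp'
  let π := Ideal.Quotient.mkₐ k (Ideal.span {γ})
  let φ' : (MvPolynomial (Fin (n + 1)) k ⧸ Ideal.span {γ}) →ₐ[k] B :=
    Ideal.Quotient.liftₐ _ φ fun a ha => (Ideal.span_singleton_le_iff_mem _).2 hγ ha
  have h1 := algebraicIndependent_option φ' (b := fun i => π (b i)) (a := π p) hb
    (fun h => hp' (Ideal.Quotient.eq_zero_iff_mem.1 h)) hp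
  have h2 := algebraicIndependent_option π (b := fun o : Option (Fin n) => o.elim p b) (a := γ)
    (by
      have : (fun o : Option (Fin n) => π (o.elim p b)) =
          fun o => o.elim (π p) fun i => π (b i) := by
        funext o; cases o <;> rfl
      rw [this]; exact h1) hγp.ne_zero
    (Ideal.Quotient.eq_zero_iff_mem.2 (Ideal.mem_span_singleton_self γ))
  have := h2.lift_cardinalMk_le_trdeg
  rw [MvPolynomial.trdeg_of_isDomain] at this
  simp only [Cardinal.mk_option, Cardinal.mk_fin, Cardinal.lift_add, Cardinal.lift_natCast,
    Cardinal.lift_one] at this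
  norm_cast at this
  omega

/-- A solution of a linear equation over a subalgebra is algebraic over it. -/
theorem isAlgebraic_of_mul_eq {A : Type*} [CommRing A] [IsDomain A] [Algebra k A]
    {S : Subalgebra k A} {a b x : A} (ha : a ∈ S) (hb : b ∈ S) (ha0 : a ≠ 0) (h : a * x = b) :
    IsAlgebraic S x :=
  IsAlgebraic.of_mul (mem_nonZeroDivisors_of_ne_zero ha0)
    (isAlgebraic_algebraMap (⟨a, ha⟩ : S)) (h ▸ isAlgebraic_algebraMap (⟨b, hb⟩ : S))

/-- `n` polynomials in `n` variables over which the variables are algebraic are algebraically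
independent. -/
theorem algebraicIndependent_of_isAlgebraic_X {n : ℕ} {u : Fin n → MvPolynomial (Fin n) k}
    (h : ∀ i, IsAlgebraic (Algebra.adjoin k (Set.range u)) (X i : MvPolynomial (Fin n) k)) :
    AlgebraicIndependent k u := by
  have : Algebra.IsAlgebraic (Algebra.adjoin k (Set.range u)) (MvPolynomial (Fin n) k) := by
    refine ⟨fun p => ?_⟩
    induction p using MvPolynomial.induction_on with
    | C a =>
      exact isAlgebraic_algebraMap (⟨C a, Subalgebra.algebraMap_mem _ a⟩ :
        Algebra.adjoin k (Set.range u))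
    | add p q hp hq => exact hp.add hq
    | mul_X p i hp => exact hp.mul (h i)
  refine (Algebra.IsAlgebraic.isTranscendenceBasis_of_lift_le_trdeg_of_finite k u ?_).1
  rw [MvPolynomial.trdeg_of_isDomain]
  simp

theorem aeval_mul_of_isHomogeneous {σ B : Type*} [CommRing B] [Algebra k B] {p : MvPolynomial σ k}
    {d : ℕ} (hp : p.IsHomogeneous d) (c : B) (v : σ → B) :
    aeval (fun i => c * v i) p = c ^ d * aeval v p := by
  rw [aeval_def, aeval_def, eval₂_eq, eval₂_eq, Finset.mul_sum]
  refine Finset.sum_congr rfl fun m hm => ?_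
  rw [hp.degree_eq_sum_deg_support hm]
  simp only [mul_pow, Finset.prod_mul_distrib, Finset.prod_pow_eq_pow_sum]
  ring

/-- For a form `n ≠ 0`, the polynomials `n X₀ Xᵢ` are algebraically independent. -/
theorem algebraicIndependent_mul_X_mul_X {n : MvPolynomial (Fin 3) k} {d : ℕ}
    (hn : n.IsHomogeneous d) (hn0 : n ≠ 0) :
    AlgebraicIndependent k fun i : Fin 3 => n * (X 0 * X i) := by
  set u : Fin 3 → MvPolynomial (Fin 3) k := fun i => n * (X 0 * X i) with hu
  set S := Algebra.adjoin k (Set.range u)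
  have huS (i) : u i ∈ S := Algebra.subset_adjoin ⟨i, rfl⟩
  have hu0 : u 0 ≠ 0 := mul_ne_zero hn0 (mul_ne_zero (X_ne_zero _) (X_ne_zero _))
  -- `n(u) = (n X₀)ᵈ n`, so that `n(u) X₀ᵈ⁺² = u₀ᵈ⁺¹`
  have hnu : aeval u n = (n * X 0) ^ d * n := by
    have : u = fun i => (n * X 0) * X i := by funext i; simp only [hu]; ring
    rw [this, aeval_mul_of_isHomogeneous hn, aeval_X_left_apply]
  have hnuS : aeval u n ∈ S := by
    simp only [S, Algebra.adjoin_range_eq_range_aeval]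
    exact ⟨n, rfl⟩
  have h0 : IsAlgebraic S (X 0 : MvPolynomial (Fin 3) k) := by
    refine IsAlgebraic.of_pow (n := d + 2) (by omega) (isAlgebraic_of_mul_eq hnuS
      (S.pow_mem (huS 0) (d + 1)) ?_ ?_)
    · rw [hnu]
      exact mul_ne_zero (pow_ne_zero _ (mul_ne_zero hn0 (X_ne_zero _))) hn0
    · rw [hnu]
      simp only [hu]
      ring
  refine algebraicIndependent_of_isAlgebraic_X fun i => ?_
  have h1 : IsAlgebraic S (u 0 * X i) := by
    have : u 0 * X i = X 0 * u i := by simp only [hu]; ring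
    rw [this]
    exact h0.mul (isAlgebraic_algebraMap (⟨u i, huS i⟩ : S))
  exact IsAlgebraic.of_mul (mem_nonZeroDivisors_of_ne_zero hu0)
    (isAlgebraic_algebraMap (⟨u 0, huS 0⟩ : S)) h1

end AlgebraicIndependence

/-! ### Function fields of curves -/

section CurveFields

variable {k F : Type*} [Field k] [Field F] [Algebra k F]

theorem IsCurveField.isAlgebraic_adjoin (hF : IsCurveField k F) :
    ∃ t : F, Algebra.IsAlgebraic (Algebra.adjoin k {t}) F := by
  obtain ⟨t, -, ht⟩ := hF
  refine ⟨t, IntermediateField.isAlgebraic_adjoin_iff_top.1 ?_⟩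
  exact Algebra.IsAlgebraic.of_finite _ _

theorem IsCurveField.trdeg_le_one (hF : IsCurveField k F) : Algebra.trdeg k F ≤ 1 := by
  obtain ⟨t, ht⟩ := hF.isAlgebraic_adjoin
  simpa using Algebra.IsAlgebraic.trdeg_le_cardinalMk k ({t} : Set F)

theorem IsCurveField.essFiniteType (hF : IsCurveField k F) : Algebra.EssFiniteType k F := by
  obtain ⟨t, -, ht⟩ := hF
  have h1 : Algebra.EssFiniteType k (IntermediateField.adjoin k {t}) :=
    IntermediateField.essFiniteType_iff.2 ⟨{t}, by simp⟩
  exact Algebra.EssFiniteType.comp k (IntermediateField.adjoin k {t}) F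

/-- A curve over a perfect field has a separating element `t`, and `dt` spans the differentials. -/
theorem IsCurveField.exists_span_eq_top [PerfectField k] (hF : IsCurveField k F) :
    ∃ ω : Ω[F⁄k], ∀ θ : Ω[F⁄k], ∃ g : F, θ = g • ω := by
  have := hF.essFiniteType
  obtain ⟨s, hs, hsep⟩ := exists_isTranscendenceBasis_and_isSeparable_of_perfectField k F
  have hcard : s.card ≤ 1 := by
    have h1 := hs.1.cardinalMk_le_trdeg.trans hF.trdeg_le_one
    simpa using h1
  obtain ⟨t, hst⟩ : ∃ t : F, s ⊆ {t} := Finset.card_le_one_iff_subset_singleton.1 hcard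
  let K := IntermediateField.adjoin k (s : Set F)
  have hK : ∀ z ∈ K, D k F z ∈ Submodule.span F {D k F t} := fun z hz => by
    induction hz using IntermediateField.adjoin_induction with
    | mem z hz =>
      rw [Finset.mem_singleton.1 (hst hz)]
      exact Submodule.mem_span_singleton_self _
    | algebraMap c => simp
    | add a b _ _ ha hb => rw [map_add]; exact add_mem ha hb
    | inv a _ ha => rw [Derivation.leibniz_inv]; exact Submodule.smul_mem _ _ ha
    | mul a b _ _ ha hb =>
      rw [Derivation.leibniz]
      exact add_mem (Submodule.smul_mem _ _ hb) (Submodule.smul_mem _ _ ha)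
  have hunr : Subsingleton Ω[F⁄K] :=
    (Algebra.FormallyUnramified.of_isSeparable K F).subsingleton_kaehlerDifferential
  refine ⟨D k F t, fun θ => ?_⟩
  have hθ : θ ∈ LinearMap.range (KaehlerDifferential.mapBaseChange k K F) := by
    rw [KaehlerDifferential.range_mapBaseChange]
    exact Subsingleton.elim _ _
  obtain ⟨y, rfl⟩ := hθ
  suffices h : KaehlerDifferential.mapBaseChange k K F y ∈ Submodule.span F {D k F t} by
    obtain ⟨g, hg⟩ := Submodule.mem_span_singleton.1 h
    exact ⟨g, hg.symm⟩
  induction y with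
  | zero => simp
  | add a b ha hb => rw [map_add]; exact add_mem ha hb
  | tmul a b =>
    rw [KaehlerDifferential.mapBaseChange_tmul]
    refine Submodule.smul_mem _ _ ?_
    have hb : b ∈ Submodule.span K (Set.range (D k K)) := by
      rw [KaehlerDifferential.span_range_derivation]; trivial
    induction hb using Submodule.span_induction with
    | mem b hb =>
      obtain ⟨z, rfl⟩ := hb
      rw [KaehlerDifferential.map_D]
      exact hK _ z.2
    | zero => simp
    | add a b _ _ ha hb => rw [map_add]; exact add_mem ha hb
    | smul c b _ hb =>
      rw [map_smul, ← algebraMap_smul F]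
      exact Submodule.smul_mem _ _ hb

theorem IsCurveField.exists_eq_smul [PerfectField k] (hF : IsCurveField k F) {ω : Ω[F⁄k]}
    (hω : ω ≠ 0) (θ : Ω[F⁄k]) : ∃ g : F, θ = g • ω := by
  obtain ⟨ω₀, h⟩ := hF.exists_span_eq_top
  obtain ⟨a, rfl⟩ := h ω
  obtain ⟨b, rfl⟩ := h θ
  have ha : a ≠ 0 := fun h => hω (by rw [h, zero_smul])
  exact ⟨b / a, by rw [smul_smul, div_mul_cancel₀ _ ha]⟩

/-- The symmetric algebra of the differentials of a curve is a polynomial ring in any nonzero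
differential. -/
theorem IsCurveField.exists_algEquiv [PerfectField k] (hF : IsCurveField k F) {ω : Ω[F⁄k]}
    (hω : ω ≠ 0) : ∃ e : SymmetricAlgebra F Ω[F⁄k] ≃ₐ[F] Polynomial F,
      e (SymmetricAlgebra.ι F Ω[F⁄k] ω) = Polynomial.X := by
  have h1 : Module.finrank F Ω[F⁄k] = 1 :=
    finrank_eq_one ω hω fun θ => (hF.exists_eq_smul hω θ).imp fun _ h => h.symm
  let b := FiniteDimensional.basisSingleton Unit h1 ω hω
  refine ⟨(SymmetricAlgebra.equivMvPolynomial b).trans (MvPolynomial.uniqueAlgEquiv F Unit), ?_⟩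
  have : ω = b () := by simp [b]
  rw [AlgEquiv.trans_apply]
  conv_lhs => rw [this]
  rw [SymmetricAlgebra.equivMvPolynomial_ι_apply]
  simp

theorem ι_ne_zero {K M : Type*} [Field K] [AddCommGroup M] [Module K M] {m : M} (hm : m ≠ 0) :
    SymmetricAlgebra.ι K M m ≠ 0 := fun h => by
  obtain ⟨f, hf⟩ := Module.Projective.exists_dual_ne_zero K hm
  exact hf (by rw [← SymmetricAlgebra.lift_ι_apply f m, h, map_zero])

theorem IsCurveField.trdeg_symmetricAlgebra_le [PerfectField k] (hF : IsCurveField k F)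
    {ω : Ω[F⁄k]} (hω : ω ≠ 0) : Algebra.trdeg k (SymmetricAlgebra F Ω[F⁄k]) ≤ 2 := by
  obtain ⟨e, -⟩ := hF.exists_algEquiv hω
  have h2 : Algebra.trdeg k F + Algebra.trdeg F (Polynomial F) = Algebra.trdeg k (Polynomial F) :=
    trdeg_add_eq k F
  rw [Polynomial.trdeg_of_isDomain] at h2
  rw [(e.restrictScalars k).trdeg_eq, ← h2, ← one_add_one_eq_two]
  gcongr
  exact hF.trdeg_le_one

end CurveFields

section CurveFields

variable {k F : Type*} [Field k] [Field F] [Algebra k F]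

theorem exists_algebraMap_eq_of_isAlgebraic [IsAlgClosed k] {r : F} (h : IsAlgebraic k r) :
    ∃ c : k, algebraMap k F c = r := by
  have := IntermediateField.isAlgebraic_adjoin_simple h.isIntegral
  have hr := IntermediateField.mem_adjoin_simple_self k r
  rw [IntermediateField.eq_bot_of_isAlgClosed_of_isAlgebraic
    (IntermediateField.adjoin k {r})] at hr
  exact IntermediateField.mem_bot.1 hr

/-- Three differentials on a curve satisfy an algebraic relation. -/
theorem IsCurveField.restrict_not_injective [PerfectField k] (hF : IsCurveField k F)
    (w : Fin 3 → Ω[F⁄k]) (hw : w 0 ≠ 0) : ¬ Function.Injective (restrict w) := fun hinj => by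
  have h : AlgebraicIndependent k fun i => SymmetricAlgebra.ι F Ω[F⁄k] (w i) := hinj
  have h1 := h.lift_cardinalMk_le_trdeg.trans
    (Cardinal.lift_le.2 (hF.trdeg_symmetricAlgebra_le hw))
  simp at h1
  norm_cast at h1

theorem algebraicIndependent_X_mul (k : Type*) [Field k] :
    AlgebraicIndependent k ![(X 0 : MvPolynomial (Fin 2) k), X 0 * X 1] := by
  set u : Fin 2 → MvPolynomial (Fin 2) k := ![X 0, X 0 * X 1] with hu
  have huS (i) : u i ∈ Algebra.adjoin k (Set.range u) := Algebra.subset_adjoin ⟨i, rfl⟩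
  refine algebraicIndependent_of_isAlgebraic_X (Fin.forall_fin_two.2 ⟨?_, ?_⟩)
  · exact isAlgebraic_algebraMap (⟨_, huS 0⟩ : Algebra.adjoin k (Set.range u))
  · exact isAlgebraic_of_mul_eq (huS 0) (huS 1) (X_ne_zero _) rfl

/-- Two differentials which are linearly independent over the algebraically closed field `k` are
algebraically independent: their quotient is not constant, hence transcendental. -/
theorem IsCurveField.algebraicIndependent_ι [IsAlgClosed k] (hF : IsCurveField k F)
    {θ₀ θ₁ : Ω[F⁄k]} (h : LinearIndependent k ![θ₀, θ₁]) :
    AlgebraicIndependent k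
      ![SymmetricAlgebra.ι F Ω[F⁄k] θ₀, SymmetricAlgebra.ι F Ω[F⁄k] θ₁] := by
  have h0 : θ₀ ≠ 0 := h.ne_zero 0
  obtain ⟨r, rfl⟩ := hF.exists_eq_smul h0 θ₁
  obtain ⟨e, he⟩ := hF.exists_algEquiv h0
  have hr : Transcendental k r := fun halg => by
    obtain ⟨c, rfl⟩ := exists_algebraMap_eq_of_isAlgebraic halg
    have h1 := LinearIndependent.pair_iff.1 h c (-1) (by
      rw [algebraMap_smul, neg_one_smul, add_neg_cancel])
    exact one_ne_zero (neg_eq_zero.1 h1.2)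
  have h1 : AlgebraicIndependent k ![(Polynomial.X : Polynomial F), Polynomial.C r] := by
    have h2 := algebraicIndependent_option
      ((Polynomial.aeval (0 : F)).restrictScalars k : Polynomial F →ₐ[k] F)
      (b := fun _ : Unit => Polynomial.C r) (a := Polynomial.X)
      (by simpa [algebraicIndependent_unique_type_iff] using hr) Polynomial.X_ne_zero (by simp)
    have h3 := h2.comp ![none, some ()] (by decide)
    convert h3 using 1
    funext i
    fin_cases i <;> rfl
  have h4 := (algebraicIndependent_X_mul k).map' (f := aeval _) h1
  refine AlgebraicIndependent.of_comp ((e.restrictScalars k : _ ≃ₐ[k] _) : _ →ₐ[k] Polynomial F) ?_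
  convert h4 using 1
  funext i
  fin_cases i
  · simp [he]
  · change e (SymmetricAlgebra.ι F _ (r • θ₀)) = aeval _ (X 0 * X 1)
    rw [map_smul, map_smul, he, Algebra.smul_def, mul_comm]
    simp

theorem Place.exists_eq_unit_mul_zpow (P : Place k F) {π : P.ring} (hπ : Irreducible π) {t : F}
    (ht : t ≠ 0) : ∃ (u : P.ringˣ) (m : ℤ), t = ((u : P.ring) : F) * (π : F) ^ m := by
  have := P.isDVR
  obtain ⟨m, u, hu⟩ := IsDiscreteValuationRing.exists_units_eq_smul_zpow_of_irreducible hπ ht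
  exact ⟨u, m, hu⟩

theorem Place.eq_zero_of_zpow_eq_unit (P : Place k F) {π : P.ring} (hπ : Irreducible π)
    {u : P.ringˣ} {m : ℤ} (h : (π : F) ^ m = ((u : P.ring) : F)) : m = 0 := by
  have key : ∀ (n : ℕ) (v : P.ringˣ), (π : F) ^ n = ((v : P.ring) : F) → n = 0 := fun n v hv => by
    by_contra hn
    have hv' : π ^ n = v := Subtype.ext hv
    exact hπ.not_isUnit ((isUnit_pow_iff hn).1 (hv' ▸ v.isUnit))
  obtain ⟨n, rfl | rfl⟩ := m.eq_nat_or_neg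
  · rw [zpow_natCast] at h
    rw [key n u h, Nat.cast_zero]
  · have hu0 : ((u⁻¹ : P.ringˣ) : P.ring) * (u : P.ring) = 1 := by simp
    have hu1 : (((u⁻¹ : P.ringˣ) : P.ring) : F) * ((u : P.ring) : F) = 1 := congrArg Subtype.val hu0
    rw [zpow_neg, zpow_natCast] at h
    rw [key n u⁻¹ (by rw [eq_inv_of_mul_eq_one_left hu1, ← h, inv_inv]), Nat.cast_zero, neg_zero]

/-- If `2η` is the divisor of a square, then `η` is principal. -/
theorem isPrincipalDivisor_of_isSquare {h : F} {η : CurveDivisor k F} (hh : IsDivisorOf h (2 • η))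
    (hsq : IsSquare h) : IsPrincipalDivisor η := by
  obtain ⟨t, rfl⟩ := hsq
  have ht : t ≠ 0 := fun h => hh.1 (by rw [h, mul_zero])
  refine ⟨t, ht, fun P => ?_⟩
  obtain ⟨π, u, hπ, hu⟩ := hh.2 P
  obtain ⟨v, m, hv⟩ := P.exists_eq_unit_mul_zpow hπ ht
  have hπ0 : (π : F) ≠ 0 := fun h0 => hπ.ne_zero (Subtype.ext h0)
  have hv0 : ((v : P.ring) : F) ≠ 0 := fun h0 => ht (by rw [hv, h0, zero_mul])
  have hw : (((u * (v⁻¹ * v⁻¹) : P.ringˣ) : P.ring) : F) *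
      (((v : P.ring) : F) * ((v : P.ring) : F)) =
      ((u : P.ring) : F) := by
    have : ((u * (v⁻¹ * v⁻¹) : P.ringˣ) * (v * v)) = u := by group
    exact congrArg (fun z : P.ringˣ => ((z : P.ring) : F)) this
  have h0 := P.eq_zero_of_zpow_eq_unit hπ (u := u * (v⁻¹ * v⁻¹)) (m := m + m - 2 * η P) ?_
  · obtain rfl : m = η P := by omega
    exact ⟨π, v, hπ, hv⟩
  · have h2 : (2 • η) P = 2 * η P := by simp
    rw [h2, ← hw, hv] at hu
    rw [zpow_sub₀ hπ0, zpow_add₀ hπ0, div_eq_iff (zpow_ne_zero _ hπ0)]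
    refine mul_left_cancel₀ (mul_ne_zero hv0 hv0) ?_
    linear_combination hu

/-! ### Rational subfields -/

/-- If `F = k(t)`, then `k(t²)` has index two in `F`. -/
theorem isHyperelliptic_of_adjoin_eq_top {t : F} (ht : Transcendental k t)
    (htop : IntermediateField.adjoin k {t} = ⊤) : IsHyperelliptic k F := by
  refine ⟨t ^ 2, ?_⟩
  set K := IntermediateField.adjoin k {t ^ 2} with hK
  have ht2 : t ^ 2 ∈ K := IntermediateField.mem_adjoin_simple_self k _
  have htK : t ∉ K := fun hmem => by
    obtain ⟨P, Q, hPQ⟩ := (IntermediateField.mem_adjoin_simple_iff k _).1 hmem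
    have hQ : Polynomial.aeval (t ^ 2) Q ≠ 0 := fun h0 => by
      rw [h0, div_zero] at hPQ
      exact ht (hPQ ▸ isAlgebraic_zero)
    have hQ0 : Q ≠ 0 := by rintro rfl; simp at hQ
    have heq : Polynomial.X * Polynomial.expand k 2 Q = Polynomial.expand k 2 P := by
      refine transcendental_iff_injective.1 ht ?_
      rw [map_mul, Polynomial.aeval_X, Polynomial.expand_aeval, Polynomial.expand_aeval]
      rw [eq_div_iff hQ] at hPQ
      exact hPQ
    have hdeg := congrArg Polynomial.natDegree heq
    rw [Polynomial.natDegree_X_mul (by rwa [Polynomial.expand_ne_zero two_pos]),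
      Polynomial.natDegree_expand, Polynomial.natDegree_expand] at hdeg
    omega
  have htop' : IntermediateField.adjoin K {t} = ⊤ := by
    rw [eq_top_iff]
    intro z _
    have hz : z ∈ IntermediateField.adjoin k {t} := htop ▸ IntermediateField.mem_top
    have hle : IntermediateField.adjoin k {t} ≤
        (IntermediateField.adjoin K {t}).restrictScalars k :=
      IntermediateField.adjoin_simple_le_iff.2 (IntermediateField.mem_adjoin_simple_self K t)
    exact hle hz
  let f : Polynomial K := Polynomial.X ^ 2 - Polynomial.C ⟨t ^ 2, ht2⟩
  have hf : f.Monic := Polynomial.monic_X_pow_sub_C _ two_ne_zero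
  have hf0 : Polynomial.aeval t f = 0 := by
    simp [f, IntermediateField.algebraMap_apply]
  have hint : IsIntegral K t := ⟨f, hf, hf0⟩
  have h1 := IntermediateField.adjoin.finrank hint
  rw [htop', IntermediateField.finrank_top'] at h1
  rw [h1]
  refine le_antisymm ?_ ?_
  · refine (Polynomial.natDegree_le_of_dvd (minpoly.dvd K t hf0) hf.ne_zero).trans ?_
    simp [f]
  · rw [minpoly.two_le_natDegree_iff hint]
    rintro ⟨z, hz⟩
    exact htK (hz ▸ z.2)

/-- A double cover `F / E` such that `E ⊆ k(t)` makes the curve hyperelliptic. -/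
theorem isHyperelliptic_of_le_adjoin [IsAlgClosed k] (hF : IsCurveField k F)
    {E : IntermediateField k F} (hE : Module.finrank E F = 2) {t : F}
    (hle : E ≤ IntermediateField.adjoin k {t}) : IsHyperelliptic k F := by
  have h1 := IntermediateField.relfinrank_mul_finrank_top hle
  rw [hE] at h1
  have hdvd : Module.finrank (IntermediateField.adjoin k {t}) F ∣ 2 :=
    ⟨_, by rw [mul_comm]; exact h1.symm⟩
  rcases (Nat.dvd_prime Nat.prime_two).1 hdvd with h | h
  · have htop : IntermediateField.adjoin k {t} = ⊤ :=
      IntermediateField.finrank_eq_one_iff_eq_top.1 h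
    refine isHyperelliptic_of_adjoin_eq_top (fun halg => ?_) htop
    obtain ⟨c, hc⟩ := exists_algebraMap_eq_of_isAlgebraic halg
    obtain ⟨z, hz, -⟩ := hF
    have hbot : IntermediateField.adjoin k {t} = ⊥ := by
      rw [IntermediateField.adjoin_simple_eq_bot_iff, IntermediateField.mem_bot]
      exact ⟨c, hc⟩
    have hz' : z ∈ (⊥ : IntermediateField k F) := by
      rw [← hbot, htop]; exact IntermediateField.mem_top
    obtain ⟨d, rfl⟩ := IntermediateField.mem_bot.1 hz'
    exact hz (isAlgebraic_algebraMap d)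
  · exact ⟨t, h⟩

/-- If `a q(b) = p(b)` is a nontrivial relation and `b` is transcendental, then `a ∈ k(b)`. -/
theorem mem_adjoin_of_mul_eq {a b : F} (hb : Transcendental k b) {p q : Polynomial k}
    (hpq : p ≠ 0 ∨ q ≠ 0)
    (h : a * Polynomial.aeval b q = Polynomial.aeval b p) : a ∈ IntermediateField.adjoin k {b} := by
  have hq : Polynomial.aeval b q ≠ 0 := fun h0 => by
    rw [h0, mul_zero] at h
    exact hpq.elim (fun hp => hb ⟨p, hp, h.symm⟩) (fun hq => hb ⟨q, hq, h0⟩)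
  rw [IntermediateField.mem_adjoin_simple_iff]
  exact ⟨p, q, by rw [eq_div_iff hq, h]⟩

/-- A conic is rational: if `1, r, s` are linearly independent over `k` and satisfy a quadratic
equation, then `r` and `s` are in a field `k(t)`. The element `t` is the projection from a point
of the conic. -/
theorem exists_mem_adjoin_of_conic [IsAlgClosed k] {r s : F}
    (hr : ∀ c d : k, s ≠ algebraMap k F c + algebraMap k F d * r) (hr' : Transcendental k r)
    {a b c d e f : k} (hne : a ≠ 0 ∨ b ≠ 0 ∨ c ≠ 0 ∨ d ≠ 0 ∨ e ≠ 0 ∨ f ≠ 0)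
    (h : algebraMap k F a + algebraMap k F b * r + algebraMap k F c * s + algebraMap k F d * r ^ 2
      + algebraMap k F e * (r * s) + algebraMap k F f * s ^ 2 = 0) :
    ∃ t : F, r ∈ IntermediateField.adjoin k {t} ∧ s ∈ IntermediateField.adjoin k {t} := by
  by_cases hf : f = 0
  · refine ⟨r, IntermediateField.mem_adjoin_simple_self k r, ?_⟩
    refine mem_adjoin_of_mul_eq hr' (q := .C c + .C e * .X)
      (p := -(.C a + .C b * .X + .C d * .X ^ 2)) ?_ ?_
    · by_contra! hc
      have e0 := congrArg (Polynomial.coeff · 0) hc.1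
      have e1 := congrArg (Polynomial.coeff · 1) hc.1
      have e2 := congrArg (Polynomial.coeff · 2) hc.1
      have e3 := congrArg (Polynomial.coeff · 0) hc.2
      have e4 := congrArg (Polynomial.coeff · 1) hc.2
      simp [Polynomial.coeff_C, Polynomial.coeff_X] at e0 e1 e2 e3 e4
      simp_all
    · rw [hf, map_zero] at h
      simp
      linear_combination h
  · -- the chord coordinate `t = s - l r`, where `(0 : 1 : l)` is a point of the conic
    obtain ⟨l, hl⟩ : ∃ l : k, d + e * l + f * l ^ 2 = 0 := by
      have hdeg : (Polynomial.C f * Polynomial.X ^ 2 + Polynomial.C e * Polynomial.X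
        + Polynomial.C d).degree ≠ 0 := by
        rw [Polynomial.degree_quadratic hf]; decide
      obtain ⟨l, hl⟩ := IsAlgClosed.exists_root _ hdeg
      refine ⟨l, ?_⟩
      simp [Polynomial.IsRoot] at hl
      linear_combination hl
    set t := s - algebraMap k F l * r with ht
    have htr : Transcendental k t := fun halg => by
      obtain ⟨c, hc⟩ := exists_algebraMap_eq_of_isAlgebraic halg
      exact hr c l (by rw [hc, ht]; ring)
    have hrt : r ∈ IntermediateField.adjoin k {t} := by
      refine mem_adjoin_of_mul_eq htr (q := .C (b + l * c) + .C (e + (l * f + l * f)) * .X)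
        (p := -(.C a + .C c * .X + .C f * .X ^ 2)) ?_ ?_
      · left
        intro hc
        have e2 := congrArg (Polynomial.coeff · 2) hc
        simp at e2
        exact hf e2
      · have hl' := congrArg (algebraMap k F) hl
        simp only [map_add, map_mul, map_pow, map_zero] at hl'
        simp [ht]
        linear_combination h - r ^ 2 * hl'
    refine ⟨t, hrt, ?_⟩
    have : s = t + algebraMap k F l * r := by rw [ht]; ring
    rw [this]
    exact add_mem (IntermediateField.mem_adjoin_simple_self k t)
      (mul_mem (IntermediateField.algebraMap_mem _ l) hrt)

end CurveFields

/-! ### Partial derivatives and quadratic forms -/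

section PartialDerivatives

variable {σ k : Type*} [Field k]

/-- Over an algebraically closed field, a polynomial all of whose partial derivatives vanish is
constant or a `p`-th power. -/
theorem exists_eq_C_or_pow_of_pderiv_eq_zero [IsAlgClosed k] {f : MvPolynomial σ k}
    (hf : ∀ i, pderiv i f = 0) : f.totalDegree = 0 ∨ ∃ p g, 2 ≤ p ∧ f = g ^ p := by
  have hcoeff : ∀ m ∈ f.support, ∀ i, ((m i : ℕ) : k) = 0 := fun m hm i => by
    by_contra h0
    have hmi : m i ≠ 0 := fun h => h0 (by rw [h, Nat.cast_zero])
    have h1 := coeff_pderiv (i := i) f (m - Finsupp.single i 1)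
    have h2 : m - Finsupp.single i 1 + Finsupp.single i 1 = m :=
      tsub_add_cancel_of_le (Finsupp.single_le_iff.2 (Nat.one_le_iff_ne_zero.2 hmi))
    rw [hf i, coeff_zero, h2] at h1
    have h3 : ((((m - Finsupp.single i 1 : σ →₀ ℕ) i : ℕ) : k) + 1) = ((m i : ℕ) : k) := by
      have : (m - Finsupp.single i 1 : σ →₀ ℕ) i + 1 = m i := by simp; omega
      exact_mod_cast congrArg (Nat.cast : ℕ → k) this
    rw [h3] at h1
    exact (mem_support_iff.1 hm) ((mul_eq_zero.1 h1.symm).resolve_right h0)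
  obtain h | ⟨p, hp, hpk⟩ := CharP.exists' k
  · left
    rw [totalDegree_eq_zero_iff]
    intro m hm i
    exact_mod_cast hcoeff m hm i
  · right
    choose root hroot using fun c : k => IsAlgClosed.exists_pow_nat_eq c hp.out.pos
    refine ⟨p, ∑ m ∈ f.support, monomial (m.mapRange (· / p) (Nat.zero_div p)) (root (coeff m f)),
      hp.out.two_le, ?_⟩
    have : ExpChar k p := .prime hp.out
    have : ExpChar (MvPolynomial σ k) p := inferInstance
    rw [sum_pow_char]
    conv_lhs => rw [f.as_sum]
    refine Finset.sum_congr rfl fun m hm => ?_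
    have hm' : p • m.mapRange (· / p) (Nat.zero_div p) = m := Finsupp.ext fun i => by
      simp [Nat.mul_div_cancel' ((CharP.cast_eq_zero_iff k p _).1 (hcoeff m hm i))]
    rw [monomial_pow, hroot, hm']

/-- The equation of a reduced irreducible hypersurface has a partial derivative which does not
vanish on it. -/
theorem exists_pderiv_notMem_span [IsAlgClosed k] {f : MvPolynomial σ k} {d : ℕ}
    (hf : f.IsHomogeneous d) (hd : d ≠ 0) (hp : Prime f) :
    ∃ i, pderiv i f ∉ Ideal.span {f} := by
  by_contra! hc
  have hdeg : f.totalDegree = d := hf.totalDegree hp.ne_zero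
  have h0 : ∀ i, pderiv i f = 0 := fun i => by
    by_contra h0
    obtain ⟨u, hu⟩ := Ideal.mem_span_singleton.1 (hc i)
    have hu0 : u ≠ 0 := by rintro rfl; exact h0 (by rw [hu, mul_zero])
    have h1 : (pderiv i f).IsHomogeneous (d - 1) := hf.pderiv
    have h2 := h1.totalDegree h0
    rw [hu, totalDegree_mul_of_isDomain hp.ne_zero hu0] at h2
    omega
  rcases exists_eq_C_or_pow_of_pderiv_eq_zero h0 with h | ⟨p, g, h2, rfl⟩
  · omega
  · exact not_irreducible_pow (by omega) hp.irreducible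

end PartialDerivatives

section Quadrics

variable {k : Type*} [Field k]

open scoped Pointwise in
theorem exists_eq_sum_of_isHomogeneous_two {n : ℕ} {p : MvPolynomial (Fin n) k}
    (hp : p.IsHomogeneous 2) :
    ∃ c : Fin n → Fin n → k, p = ∑ a, ∑ b, C (c a b) * (X a * X b) := by
  have h1 : p ∈ Submodule.span k (Set.range fun ab : Fin n × Fin n =>
      (X ab.1 * X ab.2 : MvPolynomial (Fin n) k)) := by
    rw [← mem_homogeneousSubmodule, ← homogeneousSubmodule_one_pow,
      homogeneousSubmodule_one_eq_span_X, sq, Submodule.span_mul_span] at hp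
    have : (Set.range fun ab : Fin n × Fin n => (X ab.1 * X ab.2 : MvPolynomial (Fin n) k)) =
        Set.range (X : Fin n → MvPolynomial (Fin n) k) *
          Set.range (X : Fin n → MvPolynomial (Fin n) k) := by
      ext z
      simp [Set.mem_mul]
    rw [this]
    exact hp
  obtain ⟨c, hc⟩ := (Submodule.mem_span_range_iff_exists_fun k).1 h1
  refine ⟨fun a b => c (a, b), ?_⟩
  rw [← hc, Fintype.sum_prod_type]
  simp [MvPolynomial.smul_eq_C_mul]

/-- A quadratic form which is singular at `p` is invariant under the substitution
`v ↦ v - (vⱼ / pⱼ) p`. -/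
theorem aeval_sub_eq_self_of_singular (h2 : (2 : k) ≠ 0) {q : MvPolynomial (Fin 4) k}
    (hq : q.IsHomogeneous 2) {p : Fin 4 → k} (hsing : ∀ i, eval p (pderiv i q) = 0) (j : Fin 4)
    (r : Fin 4 → k) (hr : ∃ s : k, ∀ i, r i = s * p i) :
    aeval (fun i => X i - C (r i) * X j : Fin 4 → MvPolynomial (Fin 4) k) q = q := by
  obtain ⟨s, hs⟩ := hr
  obtain ⟨c, rfl⟩ := exists_eq_sum_of_isHomogeneous_two hq
  have hD : ∀ i, ∑ b, (c i b + c b i) * r b = 0 := fun i => by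
    have := hsing i
    simp only [map_sum, Derivation.leibniz, smul_eq_mul, pderiv_C, mul_zero, add_zero, pderiv_X,
      map_mul, map_add, eval_C, eval_X, Pi.single_apply, apply_ite (eval p), map_one,
      map_zero] at this
    simp [mul_add, Finset.sum_add_distrib] at this
    rw [← Finset.sum_add_distrib] at this
    rw [← mul_zero s, ← this, Finset.mul_sum]
    exact Finset.sum_congr rfl fun b _ => by rw [hs]; ring
  have hE : ∑ a, ∑ b, c a b * (r a * r b) = 0 := by
    refine mul_left_cancel₀ h2 ?_
    have h0 := hD 0
    have h1 := hD 1
    have h2 := hD 2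
    have h3 := hD 3
    simp only [Fin.sum_univ_four] at *
    linear_combination r 0 * h0 + r 1 * h1 + r 2 * h2 + r 3 * h3
  have hD' : ∀ i, ∑ b, (C (c i b) + C (c b i)) * C (r b) = (0 : MvPolynomial (Fin 4) k) :=
      fun i => by
    rw [← C_0, ← hD i]
    simp
  have hE' : ∑ a, ∑ b, C (c a b) * (C (r a) * C (r b)) = (0 : MvPolynomial (Fin 4) k) := by
    rw [← C_0, ← hE]
    simp
  have h0 := hD' 0
  have h1 := hD' 1
  have h2 := hD' 2
  have h3 := hD' 3
  simp only [map_sum, map_mul, aeval_X, aeval_C, MvPolynomial.algebraMap_eq]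
  clear hD' hD hE hsing hq hs
  simp only [Fin.sum_univ_four] at *
  linear_combination X j ^ 2 * hE' - X j * (X 0 * h0 + X 1 * h1 + X 2 * h2 + X 3 * h3)

end Quadrics

/-! ### The cubic attached to a map from conics to quadrics -/

section Cubic

variable {k : Type*} [Field k]

/-- No multiple of a quadratic form is a nonzero multiple of the square of a prime cubic form. -/
theorem notMem_span_quadric {σ : Type*} {γ Q : MvPolynomial σ k} {c : k} (hγ : Prime γ)
    (h3 : γ.IsHomogeneous 3) (hc : c ≠ 0) (hQ : Q.IsHomogeneous 2) :
    C c * γ ^ 2 ∉ Ideal.span {Q} := fun h => by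
  have hu : IsUnit (C c : MvPolynomial σ k) := (isUnit_iff_ne_zero.2 hc).map C
  rw [Ideal.mem_span_singleton, hu.dvd_mul_left] at h
  obtain ⟨i, -, u, hi⟩ := (dvd_prime_pow hγ 2).1 h
  have hQ0 : Q ≠ 0 := left_ne_zero_of_mul (hi ▸ pow_ne_zero i hγ.ne_zero)
  have h1 := congrArg totalDegree hi
  rw [totalDegree_mul_of_isDomain hQ0 u.ne_zero, hQ.totalDegree hQ0,
    (isUnit_iff_totalDegree.1 u.isUnit).2, (h3.pow i).totalDegree (pow_ne_zero i hγ.ne_zero)] at h1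
  omega

theorem adjugate_eq_zero_of_eq_mul {B : Type*} [CommRing B] {M : Matrix (Fin 3) (Fin 3) B} {s : B}
    {t : Fin 3 → B} (h : ∀ i j, M i j = s * (t i * t j)) : M.adjugate = 0 := by
  have e : M = Matrix.of fun i j => s * (t i * t j) := Matrix.ext h
  rw [e, Matrix.adjugate_fin_three]
  ext i j
  fin_cases i <;> fin_cases j <;> simp <;> ring

/-- A symmetric matrix `M` of quadratic forms on `ℙⁿ` which becomes the matrix `s tᵢ tⱼ` of rank
one on a hypersurface that is in no quadric, has a square as its determinant. -/
theorem exists_cubic_det_eq [IsAlgClosed k] {B : Type*} [CommRing B] [IsDomain B] [Algebra k B]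
    {n : ℕ} (φ : MvPolynomial (Fin (n + 1)) k →ₐ[k] B)
    {M : Matrix (Fin 3) (Fin 3) (MvPolynomial (Fin (n + 1)) k)} (hM : M.IsSymm)
    (hdeg : ∀ i j, (M i j).IsHomogeneous 2) {s : B} (hs : s ≠ 0) {t : Fin 3 → B}
    (ht : LinearIndependent k t) (hφ : ∀ i j, φ (M i j) = s * (t i * t j))
    (hsq : ¬ IsSquare (M 0 0))
    {b : Fin n → MvPolynomial (Fin (n + 1)) k} (hb : AlgebraicIndependent k fun i => φ (b i))
    (hquad : ∀ q : MvPolynomial (Fin (n + 1)) k, q.IsHomogeneous 2 → φ q = 0 → q = 0) :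
    ∃ γ c, Prime γ ∧ γ.IsHomogeneous 3 ∧ c ≠ 0 ∧ M.det = C c * γ ^ 2 := by
  have hker : ∀ v : Fin 3 → k, M.mulVec (fun i => C (v i)) = 0 → v = 0 := fun v hv => by
    have h0 : φ (M.mulVec (fun i => C (v i)) 0) = 0 := by rw [hv]; simp
    have ht0 : t 0 ≠ 0 := ht.ne_zero 0
    have h1 : s * t 0 * ∑ j, v j • t j = 0 := by
      rw [← h0, Matrix.mulVec, dotProduct, map_sum, Finset.mul_sum]
      refine Finset.sum_congr rfl fun j _ => ?_
      rw [map_mul, hφ, ← MvPolynomial.algebraMap_eq, AlgHom.commutes, Algebra.smul_def]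
      ring
    have h2 := (mul_eq_zero.1 h1).resolve_left (mul_ne_zero hs ht0)
    exact funext (Fintype.linearIndependent_iff.1 ht v h2)
  have hadj : M.adjugate ≠ 0 := fun h0 => hsq (isSquare_of_adjugate_eq_zero hM hdeg hker h0 0)
  have hφadj : ∀ i j, φ (M.adjugate i j) = 0 := fun i j => by
    have h1 := RingHom.map_adjugate (φ : MvPolynomial (Fin (n + 1)) k →+* B) M
    have h2 : ((φ : MvPolynomial (Fin (n + 1)) k →+* B).mapMatrix M).adjugate = 0 :=
      adjugate_eq_zero_of_eq_mul (s := s) (t := t) fun i j => hφ i j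
    rw [h2] at h1
    exact congrFun (congrFun h1 i) j
  obtain ⟨i, j, hij⟩ : ∃ i j, M.adjugate i j ≠ 0 := by
    by_contra! hc
    exact hadj (Matrix.ext hc)
  obtain ⟨γ, hγ, hspan⟩ := exists_prime_ker_eq_span φ hb hij (hφadj i j)
  have hmem : ∀ p, φ p = 0 ↔ γ ∣ p := fun p => by
    rw [← Ideal.mem_span_singleton, ← hspan, RingHom.mem_ker]
  have hγdeg : 3 ≤ γ.totalDegree := by
    by_contra! hlt
    have hhom := isHomogeneous_of_dvd (isHomogeneous_adjugate hdeg i j) hij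
      ((hmem _).1 (hφadj i j))
    have h2 : (γ * X 0 ^ (2 - γ.totalDegree)).IsHomogeneous 2 := by
      have := hhom.mul (isHomogeneous_X_pow (R := k) (0 : Fin (n + 1)) (2 - γ.totalDegree))
      rwa [show γ.totalDegree + (2 - γ.totalDegree) = 2 by omega] at this
    have h3 := hquad _ h2 ((hmem _).2 (dvd_mul_right _ _))
    exact mul_ne_zero hγ.ne_zero (pow_ne_zero _ (X_ne_zero _)) h3
  obtain ⟨h3, c, hc, hdet⟩ :=
    det_eq_C_mul_sq hM hdeg hker hadj hγ (fun i j => (hmem _).1 (hφadj i j)) hγdeg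
  exact ⟨γ, c, hγ, h3, hc, hdet⟩

end Cubic

/-! ### Restriction to the curve -/

section Curve

variable {k F : Type*} [Field k] [Field F] [Algebra k F]

theorem restrict_mono {n : ℕ} (w : Fin n → Ω[F⁄k]) (i j : Fin n) :
    restrict w ((mono i j : Quad k n) : MvPolynomial (Fin n) k) =
      SymmetricAlgebra.ι F Ω[F⁄k] (w i) * SymmetricAlgebra.ι F Ω[F⁄k] (w j) := by
  simp [restrict, mono]

theorem mono_comm (k : Type*) [Field k] {n : ℕ} (i j : Fin n) : (mono i j : Quad k n) = mono j i :=
  Subtype.ext (mul_comm _ _)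

/-- The symmetric algebra of `Ω_F` is a polynomial ring in one variable, where `h T²` is a square
only if `h` is. -/
theorem IsCurveField.isSquare_of_sq_eq [PerfectField k] (hF : IsCurveField k F) {ω : Ω[F⁄k]}
    (hω : ω ≠ 0) {h : F}
    (hsq : IsSquare (h • SymmetricAlgebra.ι F Ω[F⁄k] ω ^ 2)) : IsSquare h := by
  obtain ⟨e, he⟩ := hF.exists_algEquiv hω
  obtain ⟨u, hu⟩ := hsq
  have h1 := congrArg Polynomial.leadingCoeff (congrArg e hu)
  rw [map_smul, map_pow, he, map_mul, Polynomial.leadingCoeff_mul, Polynomial.smul_eq_C_mul,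
    Polynomial.leadingCoeff_C_mul_X_pow] at h1
  exact ⟨_, h1⟩

/-- If no quadric contains the surface parametrized by the adjoint cubics, then the sextic of `ψ`
is the square of the cubic form of this surface. -/
theorem exists_sextic_eq_of_adjoint [IsAlgClosed k] (hF : IsCurveField k F) {x : Fin 4 → Ω[F⁄k]}
    {w : Fin 3 → Ω[F⁄k]} {h : F} (hw : w 0 ≠ 0) (hsq : ¬ IsSquare h)
    {ψ : Quad k 3 →ₗ[k] Quad k 4}
    (hrest : ∀ q, restrict x (ψ q : MvPolynomial (Fin 4) k) =
      h • restrict w (q : MvPolynomial (Fin 3) k))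
    {n : MvPolynomial (Fin 3) k} (hn : n.IsHomogeneous 4) (hn0 : n ≠ 0)
    {a : Fin 4 → MvPolynomial (Fin 3) k} (ha : ∀ P ∈ Quad k 4, aeval a P = 0 → P = 0)
    (hψ : ∀ q : Quad k 3, aeval a (ψ q : MvPolynomial (Fin 4) k) =
      n * (q : MvPolynomial (Fin 3) k)) :
    ∃ γ c, Prime γ ∧ γ.IsHomogeneous 3 ∧ c ≠ 0 ∧ sextic ψ = C c * γ ^ 2 := by
  refine exists_cubic_det_eq (aeval a) (s := n) (t := X)
    (M := Matrix.of fun i j => (ψ (mono i j) : MvPolynomial (Fin 4) k))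
    (b := fun i => (ψ (mono 0 i) : MvPolynomial (Fin 4) k)) ?_ ?_ hn0 ?_ ?_ ?_ ?_ ?_
  · exact Matrix.ext fun i j => by simp [mono_comm k i j]
  · exact fun i j => (ψ (mono i j)).2
  · exact linearIndependent_X _ _
  · exact fun i j => hψ _
  · rintro ⟨u, hu⟩
    refine hsq (hF.isSquare_of_sq_eq hw ⟨restrict x u, ?_⟩)
    rw [← map_mul, ← hu, Matrix.of_apply, hrest, restrict_mono, sq]
  · have := algebraicIndependent_mul_X_mul_X hn hn0
    convert this using 2 with i
    exact hψ _
  · exact fun q hq h0 => ha q hq h0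

theorem restrict_eq_of_eq_smul {n : ℕ} {y : Fin n → Ω[F⁄k]} {ρ : Fin n → F} {ω : Ω[F⁄k]}
    (hρ : ∀ i, y i = ρ i • ω) {q : MvPolynomial (Fin n) k} {d : ℕ} (hq : q.IsHomogeneous d) :
    restrict y q = SymmetricAlgebra.ι F Ω[F⁄k] ω ^ d *
      algebraMap F (SymmetricAlgebra F Ω[F⁄k]) (aeval ρ q) := by
  have h1 : (fun i => SymmetricAlgebra.ι F Ω[F⁄k] (y i)) = fun i =>
      SymmetricAlgebra.ι F Ω[F⁄k] ω * algebraMap F (SymmetricAlgebra F Ω[F⁄k]) (ρ i) := by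
    funext i
    rw [hρ i, map_smul, Algebra.smul_def, mul_comm]
  rw [restrict, h1, aeval_mul_of_isHomogeneous hq]
  congr 1
  exact aeval_algebraMap_apply _ ρ q

/-- If three independent differentials satisfy a quadratic equation, then their quotients are in
a field `k(t)`. -/
theorem IsCurveField.exists_mem_adjoin_of_restrict_eq_zero [IsAlgClosed k] (hF : IsCurveField k F)
    {y : Fin 3 → Ω[F⁄k]} (hy : LinearIndependent k y) {q : MvPolynomial (Fin 3) k}
    (hq : q.IsHomogeneous 2) (hq0 : q ≠ 0) (h0 : restrict y q = 0) :
    ∃ (t : F) (ρ : Fin 3 → F), (∀ i, y i = ρ i • y 0) ∧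
      ∀ i, ρ i ∈ IntermediateField.adjoin k {t} := by
  have hy0 : y 0 ≠ 0 := hy.ne_zero 0
  choose ρ hρ using fun i => hF.exists_eq_smul hy0 (y i)
  have hρ0 : ρ 0 = 1 := by
    have := hρ 0
    rw [← sub_eq_zero, ← one_smul F (y 0), smul_smul, ← sub_smul, mul_one] at this
    exact (sub_eq_zero.1 ((smul_eq_zero.1 this).resolve_right hy0)).symm
  have hq1 : aeval ρ q = 0 := by
    rw [restrict_eq_of_eq_smul hρ hq] at h0
    have := (mul_eq_zero.1 h0).resolve_left (pow_ne_zero _ (ι_ne_zero hy0))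
    exact (SymmetricAlgebra.algebraMap_eq_zero_iff _ _).1 this
  have hlin : ∀ c d e : k, algebraMap k F c + algebraMap k F d * ρ 1 + algebraMap k F e * ρ 2 = 0 →
      c = 0 ∧ d = 0 ∧ e = 0 := fun c d e h => by
    have h1 := Fintype.linearIndependent_iff.1 hy ![c, d, e] ?_
    · exact ⟨h1 0, h1 1, h1 2⟩
    · rw [Fin.sum_univ_three, hρ 1, hρ 2]
      simp only [Matrix.cons_val]
      rw [← algebraMap_smul F c, ← algebraMap_smul F d, ← algebraMap_smul F e, smul_smul, smul_smul,
        ← add_smul, ← add_smul, h, zero_smul]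
  obtain ⟨c, rfl⟩ := exists_eq_sum_of_isHomogeneous_two hq
  have hr : ∀ a b : k, ρ 2 ≠ algebraMap k F a + algebraMap k F b * ρ 1 := fun a b h =>
    one_ne_zero (hlin (-a) (-b) 1 (by rw [h]; simp only [map_neg, map_one]; ring)).2.2
  have hr' : Transcendental k (ρ 1) := fun halg => by
    obtain ⟨a, ha⟩ := exists_algebraMap_eq_of_isAlgebraic halg
    exact one_ne_zero (hlin (-a) 1 0 (by rw [← ha]; simp)).2.1
  have hne : c 0 0 ≠ 0 ∨ c 0 1 + c 1 0 ≠ 0 ∨ c 0 2 + c 2 0 ≠ 0 ∨ c 1 1 ≠ 0 ∨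
      c 1 2 + c 2 1 ≠ 0 ∨ c 2 2 ≠ 0 := by
    by_contra! hc
    obtain ⟨e1, e2, e3, e4, e5, e6⟩ := hc
    refine hq0 ?_
    have e2' : (C (c 0 1) + C (c 1 0) : MvPolynomial (Fin 3) k) = 0 := by rw [← C_add, e2, C_0]
    have e3' : (C (c 0 2) + C (c 2 0) : MvPolynomial (Fin 3) k) = 0 := by rw [← C_add, e3, C_0]
    have e5' : (C (c 1 2) + C (c 2 1) : MvPolynomial (Fin 3) k) = 0 := by rw [← C_add, e5, C_0]
    simp only [Fin.sum_univ_three, e1, e4, e6, C_0]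
    linear_combination X 0 * X 1 * e2' + X 0 * X 2 * e3' + X 1 * X 2 * e5'
  simp only [Fin.sum_univ_three, map_add, map_mul, aeval_X, aeval_C, hρ0] at hq1
  obtain ⟨t, h1, h2⟩ := exists_mem_adjoin_of_conic hr hr' hne
    (by simp only [map_add]; linear_combination hq1)
  refine ⟨t, ρ, hρ, fun i => ?_⟩
  fin_cases i
  · exact hρ0 ▸ one_mem _
  · exact h1
  · exact h2

/-- If the products `wᵢ wⱼ` are, up to the factor `h`, quadratic forms in three independent
differentials `yᵢ`, and if the Prym canonical map has degree two, then the `yᵢ` do not satisfy a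
quadratic equation: a conic is rational, and its function field `k(t)` would be between that of the
Prym canonical curve and `F`. -/
theorem IsCurveField.restrict_ne_zero_of_bielliptic [IsAlgClosed k] (hF : IsCurveField k F)
    (hC : ¬ IsHyperelliptic k F) {w : Fin 3 → Ω[F⁄k]} (hw : LinearIndependent k w) {h : F}
    (hh : h ≠ 0) (hE : Module.finrank (prymField w) F = 2)
    {y : Fin 3 → Ω[F⁄k]} (hy : LinearIndependent k y)
    {M : Fin 3 → Fin 3 → MvPolynomial (Fin 3) k} (hM : ∀ i j, (M i j).IsHomogeneous 2)
    (hMw : ∀ i j, restrict y (M i j) =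
      h • (SymmetricAlgebra.ι F Ω[F⁄k] (w i) * SymmetricAlgebra.ι F Ω[F⁄k] (w j)))
    {q : MvPolynomial (Fin 3) k} (hq : q.IsHomogeneous 2) (h0 : restrict y q = 0) : q = 0 := by
  by_contra hq0
  obtain ⟨t, ρ, hρ, ht⟩ := hF.exists_mem_adjoin_of_restrict_eq_zero hy hq hq0 h0
  have hy0 := ι_ne_zero (K := F) (hy.ne_zero 0)
  have hmem : ∀ P : MvPolynomial (Fin 3) k, aeval ρ P ∈ IntermediateField.adjoin k {t} :=
      fun P => by
    induction P using MvPolynomial.induction_on with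
    | C a => rw [aeval_C]; exact IntermediateField.algebraMap_mem _ a
    | add P P' h h' => rw [map_add]; exact add_mem h h'
    | mul_X P i h => rw [map_mul, aeval_X]; exact mul_mem h (ht i)
  refine hC (isHyperelliptic_of_le_adjoin hF hE (t := t) ?_)
  rw [prymField, IntermediateField.adjoin_le_iff]
  rintro g ⟨i, j, hij⟩
  have hwj := ι_ne_zero (K := F) (hw.ne_zero j)
  have e1 := hMw i j
  have e2 := hMw j j
  rw [restrict_eq_of_eq_smul hρ (hM _ _)] at e1 e2
  rw [hij, map_smul] at e1
  have hjj : aeval ρ (M j j) ≠ 0 := fun h' => by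
    rw [h', map_zero, mul_zero] at e2
    exact smul_ne_zero hh (mul_ne_zero hwj hwj) e2.symm
  have e3 : aeval ρ (M i j) = g * aeval ρ (M j j) := by
    rw [← sub_eq_zero, ← SymmetricAlgebra.algebraMap_eq_zero_iff Ω[F⁄k]]
    refine (mul_eq_zero.1 (?_ : SymmetricAlgebra.ι F Ω[F⁄k] (y 0) ^ 2 * _ = 0)).resolve_left
      (pow_ne_zero 2 hy0)
    rw [map_sub, mul_sub, e1, map_mul, mul_left_comm, e2]
    simp only [Algebra.smul_def]
    ring
  rw [← mul_div_cancel_right₀ g hjj, ← e3]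
  exact div_mem (hmem _) (hmem _)

end Curve

/-! ### Projection from a vertex -/

section Projection

variable {k F : Type*} [Field k] [Field F] [Algebra k F]

/-- The pull-back of forms along the projection from `p`: the coordinates of the plane are the
linear forms `vᵢ - (pᵢ / pⱼ) vⱼ` with `i ≠ j`, which vanish at `p`. -/
noncomputable def projPullback (p : Fin 4 → k) (j : Fin 4) :
    MvPolynomial (Fin 3) k →ₐ[k] MvPolynomial (Fin 4) k :=
  aeval fun i => X (j.succAbove i) - C (p (j.succAbove i) / p j) * X j

/-- The restriction of forms to the plane `vⱼ = 0`, a section of the projection from `p`. -/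
noncomputable def planeRestrict (k : Type*) [Field k] (j : Fin 4) :
    MvPolynomial (Fin 4) k →ₐ[k] MvPolynomial (Fin 3) k :=
  aeval (j.insertNth (α := fun _ => MvPolynomial (Fin 3) k) 0 X)

theorem planeRestrict_projPullback (p : Fin 4 → k) (j : Fin 4) (P : MvPolynomial (Fin 3) k) :
    planeRestrict k j (projPullback p j P) = P := by
  have : (planeRestrict k j).comp (projPullback p j) = AlgHom.id k _ := by
    refine MvPolynomial.algHom_ext fun i => ?_
    simp [planeRestrict, projPullback]
  exact DFunLike.congr_fun this P

theorem isHomogeneous_planeRestrict (j : Fin 4) {P : MvPolynomial (Fin 4) k} {d : ℕ}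
    (hP : P.IsHomogeneous d) : (planeRestrict k j P).IsHomogeneous d := by
  have h := hP.aeval (n := 1) (j.insertNth (α := fun _ => MvPolynomial (Fin 3) k) 0 X) fun i => ?_
  · rwa [one_mul] at h
  · obtain rfl | ⟨i, rfl⟩ := j.eq_self_or_eq_succAbove i
    · rw [Fin.insertNth_apply_same]; exact isHomogeneous_zero _ _ _
    · rw [Fin.insertNth_apply_succAbove]; exact isHomogeneous_X _ _

theorem isHomogeneous_projPullback (p : Fin 4 → k) (j : Fin 4) {P : MvPolynomial (Fin 3) k} {d : ℕ}
    (hP : P.IsHomogeneous d) : (projPullback p j P).IsHomogeneous d := by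
  have h := hP.aeval (n := 1) (fun i => X (j.succAbove i) - C (p (j.succAbove i) / p j) * X j)
    fun i => (isHomogeneous_X _ _).sub ((isHomogeneous_X _ _).C_mul _)
  rwa [one_mul] at h

/-- A quadric which is singular at `p` is a cone: the pull-back of its section by a plane. -/
theorem projPullback_planeRestrict (h2 : (2 : k) ≠ 0) {p : Fin 4 → k} {j : Fin 4} (hj : p j ≠ 0)
    {q : MvPolynomial (Fin 4) k} (hq : q.IsHomogeneous 2)
    (hsing : ∀ i, eval p (pderiv i q) = 0) : projPullback p j (planeRestrict k j q) = q := by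
  conv_rhs => rw [← aeval_sub_eq_self_of_singular h2 hq hsing j (fun i => p i / p j)
    ⟨(p j)⁻¹, fun i => div_eq_inv_mul _ _⟩]
  rw [← AlgHom.comp_apply]
  congr 1
  refine MvPolynomial.algHom_ext fun i => ?_
  obtain rfl | ⟨i, rfl⟩ := j.eq_self_or_eq_succAbove i
  · simp [planeRestrict, projPullback, hj]
  · simp [planeRestrict, projPullback]

/-- The differentials that are the coordinates of the projection of the canonical curve from `p`. -/
noncomputable def projForms (x : Fin 4 → Ω[F⁄k]) (p : Fin 4 → k) (j : Fin 4) (i : Fin 3) : Ω[F⁄k] :=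
  x (j.succAbove i) - (p (j.succAbove i) / p j) • x j

theorem linearIndependent_projForms {x : Fin 4 → Ω[F⁄k]} (hx : LinearIndependent k x)
    (p : Fin 4 → k) (j : Fin 4) : LinearIndependent k (projForms x p j) := by
  rw [Fintype.linearIndependent_iff] at hx ⊢
  intro v hv i
  have := hx (j.insertNth (α := fun _ => k) (-∑ i, v i * (p (j.succAbove i) / p j)) v) ?_
    (j.succAbove i)
  · rwa [Fin.insertNth_apply_succAbove] at this
  · rw [Fin.sum_univ_succAbove _ j]
    simp only [Fin.insertNth_apply_same, Fin.insertNth_apply_succAbove]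
    rw [← hv, neg_smul, Finset.sum_smul, neg_add_eq_sub, ← Finset.sum_sub_distrib]
    exact Finset.sum_congr rfl fun i _ => by rw [projForms, smul_sub, smul_smul]

theorem restrict_projPullback (x : Fin 4 → Ω[F⁄k]) (p : Fin 4 → k) (j : Fin 4)
    (P : MvPolynomial (Fin 3) k) :
    restrict x (projPullback p j P) = restrict (projForms x p j) P := by
  rw [← AlgHom.comp_apply]
  congr 1
  refine MvPolynomial.algHom_ext fun i => ?_
  simp only [AlgHom.comp_apply, restrict, projPullback, aeval_X, map_sub, map_mul, aeval_C,
    projForms, LinearMap.map_smul_of_tower, Algebra.smul_def]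

end Projection

/-! ### The bielliptic case -/

section Curve

variable {k F : Type*} [Field k] [Field F] [Algebra k F]

theorem linearIndependent_ι {ι : Type*} {w : ι → Ω[F⁄k]} (hw : LinearIndependent k w) :
    LinearIndependent k fun i => SymmetricAlgebra.ι F Ω[F⁄k] (w i) := by
  refine hw.map' ((SymmetricAlgebra.ι F Ω[F⁄k]).restrictScalars k) (LinearMap.ker_eq_bot'.2 ?_)
  intro m hm
  by_contra h0
  exact ι_ne_zero (K := F) h0 hm

/-- In the bielliptic case the quadrics `ψ(q)` are cones with vertex `p` over the conics of the
plane, where the projection of the canonical curve is not in a conic. -/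
theorem IsPsiBielliptic.exists_sextic_eq_sq [IsAlgClosed k] (h2 : (2 : k) ≠ 0)
    (hF : IsCurveField k F) (hC : ¬ IsHyperelliptic k F) {x : Fin 4 → Ω[F⁄k]}
    (hx : LinearIndependent k x) {w : Fin 3 → Ω[F⁄k]} (hw : LinearIndependent k w) {h : F}
    (hh : h ≠ 0) (hsq : ¬ IsSquare h) {ψ : Quad k 3 →ₗ[k] Quad k 4}
    (hψ : IsPsiBielliptic x w h ψ) :
    ∃ γ : MvPolynomial (Fin 4) k, γ.IsHomogeneous 3 ∧ sextic ψ = γ ^ 2 ∧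
      ∀ Q : MvPolynomial (Fin 4) k, Q.IsHomogeneous 2 → γ ^ 2 ∉ Ideal.span {Q} := by
  obtain ⟨f, p, -, hE, ⟨hp, -⟩, hψ⟩ := hψ
  obtain ⟨j, hj⟩ := Function.ne_iff.1 hp
  have hy := linearIndependent_projForms hx p j
  let M : Matrix (Fin 3) (Fin 3) (MvPolynomial (Fin 3) k) :=
    Matrix.of fun a b => planeRestrict k j (ψ (mono a b) : MvPolynomial (Fin 4) k)
  have hM : ∀ a b, (M a b).IsHomogeneous 2 := fun a b => isHomogeneous_planeRestrict j (ψ _).2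
  have hpull : ∀ a b, projPullback p j (M a b) = ψ (mono a b) := fun a b =>
    projPullback_planeRestrict h2 hj (ψ _).2 (hψ _).1
  have hMw : ∀ a b, restrict (projForms x p j) (M a b) =
      h • (SymmetricAlgebra.ι F Ω[F⁄k] (w a) * SymmetricAlgebra.ι F Ω[F⁄k] (w b)) := fun a b => by
    rw [← restrict_projPullback, hpull, (hψ _).2, restrict_mono]
  have hw0 := hw.ne_zero 0
  have hMsq : ¬ IsSquare (M 0 0) := by
    rintro ⟨u, hu⟩
    refine hsq (hF.isSquare_of_sq_eq hw0 ⟨restrict (projForms x p j) u, ?_⟩)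
    rw [← map_mul, ← hu, hMw, sq]
  have hind : AlgebraicIndependent k fun i : Fin 2 =>
      restrict (projForms x p j) (X (![0, 1] i)) := by
    have h4 : LinearIndependent k ![projForms x p j 0, projForms x p j 1] := by
      have := hy.comp ![0, 1] (by decide)
      convert this using 1
      funext i
      fin_cases i <;> rfl
    convert hF.algebraicIndependent_ι h4 using 1
    funext i
    fin_cases i <;> simp [restrict]
  obtain ⟨γ, c, hγ, h3, hc, hdet⟩ := exists_cubic_det_eq (restrict (projForms x p j)) (M := M)
    (Matrix.ext fun a b => by simp [M, mono_comm k a b]) hM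
    (s := algebraMap F _ h) (fun h0 => hh ((SymmetricAlgebra.algebraMap_eq_zero_iff _ _).1 h0))
    (linearIndependent_ι hw) (fun a b => by rw [hMw, Algebra.smul_def]) hMsq hind
    fun q hq h0 => hF.restrict_ne_zero_of_bielliptic hC hw hh hE hy hM hMw hq h0
  obtain ⟨r, hr⟩ := IsAlgClosed.exists_pow_nat_eq c two_pos
  have hdet' : sextic ψ = C c * projPullback p j γ ^ 2 := by
    have h1 : sextic ψ = projPullback p j M.det := by
      rw [sextic, AlgHom.map_det]
      congr 1
      exact Matrix.ext fun a b => (hpull a b).symm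
    rw [h1, hdet, map_mul, map_pow, ← MvPolynomial.algebraMap_eq, AlgHom.commutes,
      ← MvPolynomial.algebraMap_eq]
  have hsqr : C c * projPullback p j γ ^ 2 = (C r * projPullback p j γ) ^ 2 := by
    rw [← hr, C_pow, mul_pow]
  refine ⟨C r * projPullback p j γ, (isHomogeneous_projPullback p j h3).C_mul r,
    hdet'.trans hsqr, fun Q hQ hmem => ?_⟩
  rw [← hsqr] at hmem
  refine notMem_span_quadric hγ h3 hc (isHomogeneous_planeRestrict j hQ) ?_
  have h1 := Ideal.mem_map_of_mem (planeRestrict k j) hmem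
  rw [Ideal.map_span, Set.image_singleton, map_mul, map_pow, planeRestrict_projPullback,
    ← MvPolynomial.algebraMap_eq, AlgHom.commutes] at h1
  exact h1

end Curve

/-! ### Congruence modulo the canonical quadric -/

section Curve

variable {k F : Type*} [Field k] [Field F] [Algebra k F]

/-- Multiplying by the square of a partial derivative of the sextic that does not vanish on the
curve shows that `ψ(q)` restricts to `h q` on the curve, by the definition of the adjoint cubics
and of the scalar in `n`. -/
theorem restrict_eq_of_adjoint [IsAlgClosed k] (hF : IsCurveField k F) {x : Fin 4 → Ω[F⁄k]}
    {w : Fin 3 → Ω[F⁄k]} (hw : LinearIndependent k w) {h : F} (hh : h ≠ 0)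
    {ψ : Quad k 3 →ₗ[k] Quad k 4}
    {f n : MvPolynomial (Fin 3) k} {a : Fin 4 → MvPolynomial (Fin 3) k}
    (hf : IsPrymCanonicalEquation w 6 f) (ha : IsAdjointBasis x w f a)
    (hn : ∀ (i : Fin 3) (g : F), w (i + 1) = g • w i →
      restrict w n * resNum (w i) g ^ 2 = h • restrict w (pderiv (i + 2) f) ^ 2)
    (hψ : ∀ q : Quad k 3, aeval a (ψ q : MvPolynomial (Fin 4) k) =
      n * (q : MvPolynomial (Fin 3) k)) :
    n ≠ 0 ∧ ∀ q, restrict x (ψ q : MvPolynomial (Fin 4) k) =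
      h • restrict w (q : MvPolynomial (Fin 3) k) := by
  obtain ⟨hf6, hker⟩ := hf
  have hf0 : f ≠ 0 := fun h0 => by
    refine hF.restrict_not_injective w (hw.ne_zero 0) ((RingHom.injective_iff_ker_eq_bot _).2 ?_)
    rw [hker, h0, Ideal.span_singleton_eq_bot]
  have hprime : Prime f := by
    rw [← Ideal.span_singleton_prime hf0, ← hker]
    exact RingHom.ker_isPrime _
  obtain ⟨l, hl⟩ := exists_pderiv_notMem_span hf6 (by norm_num) hprime
  obtain ⟨i, rfl⟩ : ∃ i, i + 2 = l := ⟨l - 2, sub_add_cancel _ _⟩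
  rw [← hker, RingHom.mem_ker] at hl
  obtain ⟨g, hg⟩ := hF.exists_eq_smul (hw.ne_zero i) (w (i + 1))
  have hn' := hn i g hg
  refine ⟨?_, fun q => ?_⟩
  · rintro rfl
    rw [map_zero, zero_mul] at hn'
    exact smul_ne_zero hh (pow_ne_zero 2 hl) hn'.symm
  · refine mul_left_cancel₀ (pow_ne_zero 2 hl) ?_
    -- both sides are `n q` times the square of the numerator of the residue
    have h1 : restrict w (pderiv (i + 2) f) ^ 2 * restrict x (ψ q : MvPolynomial (Fin 4) k) =
        resNum (w i) g ^ 2 * restrict w (aeval a (ψ q : MvPolynomial (Fin 4) k)) := by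
      have hq : (ψ q : MvPolynomial (Fin 4) k).IsHomogeneous 2 := (ψ q).2
      have hx : restrict x (ψ q : MvPolynomial (Fin 4) k) =
        aeval (fun m => SymmetricAlgebra.ι F Ω[F⁄k] (x m)) (ψ q : MvPolynomial (Fin 4) k) := rfl
      rw [hx, ← aeval_mul_of_isHomogeneous hq, ← AlgHom.comp_apply, comp_aeval,
        ← aeval_mul_of_isHomogeneous hq]
      congr 2
      funext m
      have := (ha m).2 i g hg
      rw [mul_comm] at this
      rw [this, mul_comm]
    rw [h1, hψ, map_mul, ← mul_assoc, mul_comm (resNum _ _ ^ 2), hn']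
    simp only [Algebra.smul_def]
    ring

/-- In both cases, `ψ(q)` cuts out on the curve the same section as the conic `q`, and the sextic of
`ψ` is the square of a cubic form and not a multiple of a quadric. -/
theorem IsPsi.exists_sextic_eq_sq [IsAlgClosed k] (h2 : (2 : k) ≠ 0)
    (hF : IsCurveField k F) (hC : ¬ IsHyperelliptic k F) {x : Fin 4 → Ω[F⁄k]}
    (hx : LinearIndependent k x) {w : Fin 3 → Ω[F⁄k]} (hw : LinearIndependent k w) {h : F}
    (hh : h ≠ 0) (hsq : ¬ IsSquare h) {ψ : Quad k 3 →ₗ[k] Quad k 4} (hψ : IsPsi x w h ψ) :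
    (∀ q, restrict x (ψ q : MvPolynomial (Fin 4) k) =
      h • restrict w (q : MvPolynomial (Fin 3) k)) ∧
    ∃ γ : MvPolynomial (Fin 4) k, γ.IsHomogeneous 3 ∧ sextic ψ = γ ^ 2 ∧
      ∀ Q : MvPolynomial (Fin 4) k, Q.IsHomogeneous 2 → γ ^ 2 ∉ Ideal.span {Q} := by
  rcases hψ with ⟨f, n, a, hf, ha, hquad, hn, hnh, hψ⟩ | hψ
  · obtain ⟨hn0, hrest⟩ := restrict_eq_of_adjoint hF hw hh hf ha hnh hψ
    obtain ⟨γ, c, hγ, h3, hc, hdet⟩ :=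
      exists_sextic_eq_of_adjoint hF (hw.ne_zero 0) hsq hrest hn hn0 hquad hψ
    obtain ⟨r, hr⟩ := IsAlgClosed.exists_pow_nat_eq c two_pos
    have hsqr : C c * γ ^ 2 = (C r * γ) ^ 2 := by rw [← hr, C_pow, mul_pow]
    exact ⟨hrest, C r * γ, h3.C_mul r, hdet.trans hsqr,
      fun Q hQ => hsqr ▸ notMem_span_quadric hγ h3 hc hQ⟩
  · refine ⟨?_, hψ.exists_sextic_eq_sq h2 hF hC hx hw hh hsq⟩
    obtain ⟨_, _, -, -, -, hψ⟩ := hψ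
    exact fun q => (hψ q).2

/-- Congruent matrices have congruent determinants. -/
theorem sextic_sub_mem {I : Ideal (MvPolynomial (Fin 4) k)} {ψ ρ : Quad k 3 →ₗ[k] Quad k 4}
    (h : ∀ q, (ψ q : MvPolynomial (Fin 4) k) - ρ q ∈ I) : sextic ψ - sextic ρ ∈ I := by
  rw [← Ideal.Quotient.mk_eq_mk_iff_sub_mem, sextic, sextic, RingHom.map_det, RingHom.map_det]
  congr 1
  exact Matrix.ext fun i j => (Ideal.Quotient.mk_eq_mk_iff_sub_mem _ _).2 (h _)

theorem restrict_sextic {x : Fin 4 → Ω[F⁄k]} {w : Fin 3 → Ω[F⁄k]} {h : F}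
    {ψ : Quad k 3 →ₗ[k] Quad k 4}
    (hψ : ∀ q, restrict x (ψ q : MvPolynomial (Fin 4) k) =
      h • restrict w (q : MvPolynomial (Fin 3) k)) : restrict x (sextic ψ) = 0 := by
  rw [sextic, AlgHom.map_det, Matrix.det_fin_three]
  simp only [AlgHom.mapMatrix_apply, Matrix.map_apply, Matrix.of_apply, hψ, restrict_mono,
    Algebra.smul_def]
  ring

end Curve

end PrymCurve

open PrymCurve

theorem mainTheorem3 {k F : Type*} [Field k] [IsAlgClosed k] (h2 : (2 : k) ≠ 0)
    [Field F] [Algebra k F]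
    -- a non-hyperelliptic curve of genus four, with function field `F`
    (hF : PrymCurve.IsCurveField k F) (hgenus : PrymCurve.genus k F = 4)
    (hC : ¬ PrymCurve.IsHyperelliptic k F)
    -- a nontrivial two-torsion class, represented by the divisor `η`, with `div h = 2 η`
    (η : PrymCurve.CurveDivisor k F) (hη : ¬ PrymCurve.IsPrincipalDivisor η)
    (h : F) (hh : PrymCurve.IsDivisorOf h (2 • η))
    -- coordinates: bases of `H⁰(Ω_C)` and `H⁰(Ω_C(η))`
    (x : Fin 4 → Ω[F⁄k]) (hx : PrymCurve.IsBasisOf x (PrymCurve.H0 0))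
    (w : Fin 3 → Ω[F⁄k]) (hw : PrymCurve.IsBasisOf w (PrymCurve.H0 η))
    -- the geometric map `ψ`
    (ψ : PrymCurve.Quad k 3 →ₗ[k] PrymCurve.Quad k 4) (hψ : PrymCurve.IsPsi x w h ψ)
    -- the canonical quadric: a generator of the kernel of `φ`
    (Q : PrymCurve.lehaviSpace x w h)
    (hQ : LinearMap.ker (PrymCurve.lehaviMap x w h) = Submodule.span k {Q})
    -- an arbitrary right inverse of `φ`
    (ψ' : PrymCurve.Quad k 3 →ₗ[k] PrymCurve.lehaviSpace x w h)
    (hψ' : PrymCurve.lehaviMap x w h ∘ₗ ψ' = LinearMap.id) :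
    let I : Ideal (MvPolynomial (Fin 4) k) :=
      Ideal.span {(PrymCurve.lehaviIncl x w h Q : MvPolynomial (Fin 4) k)}
    let G : MvPolynomial (Fin 4) k := PrymCurve.sextic ψ
    let G' : MvPolynomial (Fin 4) k := PrymCurve.sextic (PrymCurve.lehaviIncl x w h ∘ₗ ψ')
    G - G' ∈ I ∧
    (∃ γ : MvPolynomial (Fin 4) k, γ.IsHomogeneous 3 ∧ γ ^ 2 - G' ∈ I) ∧
    ∀ γ : MvPolynomial (Fin 4) k, γ.IsHomogeneous 3 → γ ^ 2 - G' ∈ I →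
      PrymCurve.restrict x γ = 0 ∧ γ ∉ I := by
  intro I G G'
  have hsq : ¬ IsSquare h := fun hsq => hη (isPrincipalDivisor_of_isSquare hh hsq)
  obtain ⟨hrest, γ₀, hγ₀, hG, hGQ⟩ := hψ.exists_sextic_eq_sq h2 hF hC hx.1 hw.1 hh.1 hsq
  have hrest' : ∀ q, restrict x ((lehaviIncl x w h ∘ₗ ψ') q : MvPolynomial (Fin 4) k) =
      h • restrict w (q : MvPolynomial (Fin 3) k) := fun q => by
    have h1 : h • restrict w ((ψ' q).1.1 : MvPolynomial (Fin 3) k) = restrict x ((ψ' q).1.2) :=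
      (ψ' q).2
    have h3 : (ψ' q).1.1 = q := LinearMap.congr_fun hψ' q
    rw [h3] at h1
    exact h1.symm
  -- a quadric that vanishes on the curve is in the kernel of `φ`
  have hI : ∀ q : Quad k 4, restrict x (q : MvPolynomial (Fin 4) k) = 0 →
      (q : MvPolynomial (Fin 4) k) ∈ I := fun q hq => by
    let z : lehaviSpace x w h := ⟨(0, q), by
      change h • restrict w ((0 : Quad k 3) : MvPolynomial (Fin 3) k) = restrict x _
      rw [hq, ZeroMemClass.coe_zero, map_zero, smul_zero]⟩
    have hz : z ∈ LinearMap.ker (lehaviMap x w h) := rfl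
    rw [hQ, Submodule.mem_span_singleton] at hz
    obtain ⟨c, hc⟩ := hz
    have h1 : q = c • lehaviIncl x w h Q := by
      rw [← map_smul, hc]; rfl
    rw [h1, Submodule.coe_smul, MvPolynomial.smul_eq_C_mul]
    exact Ideal.mul_mem_left _ _ (Ideal.mem_span_singleton_self _)
  have hGG : G - G' ∈ I := sextic_sub_mem fun q => by
    have := hI (ψ q - (lehaviIncl x w h ∘ₗ ψ') q) (by
      rw [Submodule.coe_sub, map_sub, hrest, hrest', sub_self])
    exact this
  have hQ0 : restrict x (lehaviIncl x w h Q : MvPolynomial (Fin 4) k) = 0 := by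
    have h1 : h • restrict w (Q.1.1 : MvPolynomial (Fin 3) k) = restrict x Q.1.2 := Q.2
    have h3 : Q ∈ LinearMap.ker (lehaviMap x w h) := hQ ▸ Submodule.mem_span_singleton_self Q
    have h4 : Q.1.1 = 0 := h3
    rw [h4, ZeroMemClass.coe_zero, map_zero, smul_zero] at h1
    exact h1.symm
  refine ⟨hGG, ⟨γ₀, hγ₀, hG ▸ hGG⟩, fun γ _ hγG => ⟨?_, fun hγI => ?_⟩⟩
  · have h1 : I ≤ RingHom.ker (restrict x) :=
      (Ideal.span_singleton_le_iff_mem _).2 ((RingHom.mem_ker).2 hQ0)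
    have h3 := (RingHom.mem_ker).1 (h1 hγG)
    rw [map_sub, restrict_sextic hrest', sub_zero, map_pow] at h3
    exact pow_eq_zero_iff two_ne_zero |>.1 h3
  · refine hGQ _ (lehaviIncl x w h Q).2 (?_ : γ₀ ^ 2 ∈ I)
    have h1 : γ₀ ^ 2 - G' ∈ I := hG ▸ hGG
    have h3 : γ ^ 2 ∈ I := Ideal.pow_mem_of_mem I hγI 2 two_pos
    have h4 := I.add_mem (I.sub_mem h1 hγG) h3
    rwa [show γ₀ ^ 2 - G' - (γ ^ 2 - G') + γ ^ 2 = γ₀ ^ 2 by ring] at h4
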